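/- Let $\mathbb F$ be a field of characteristic $p>3$, let $m,n\ge 3$ be integers and let $\underline t=(t_1,\dots,t_m)$ be a tuple of positive integers. Let $\mathfrak A(m,n)=\mathfrak A(m)\otimes\Lambda(n)$ be the tensor product of the divided power algebra $\mathfrak A(m)$ (basis $x^{(\alpha)}$, $\alpha\in\mathbb N_0^m$, with $x^{(\alpha)}x^{(\beta)}=\binom{\alpha+\beta}{\alpha}x^{(\alpha+\beta)}$) and the exterior algebra $\Lambda(n)$ in the odd variables $x_{m+1},\dots,x_{m+n}$ (basis $x^u=x_{i_1}\cdots x_{i_k}$ for $u=\{i_1<\dots<i_k\}\subseteq\{m+1,\dots,m+n\}$). Let $D_1,\dots,D_{m+n}$ be the superderivations of $\mathfrak A(m,n)$ given by $D_i(x^{(\alpha)}x^u)=x^{(\alpha-\varepsilon_i)}x^u$ for $i\le m$ (where $x^{(\beta)}:=0$ if $\beta\notin\mathbb N_0^m$) and $D_k(x^{(\alpha)}x^u)=x^{(\alpha)}\,\partial x^u/\partial x_k$ for $k>m$. Let $\mathfrak A(m,n;\underline t)$ be the span of all $x^{(\alpha)}x^u$ with $0\le\alpha_i\le p^{t_i}-1$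 for all $i$, let $$W(m,n;\underline t)=\Big\{\sum_{r=1}^{m+n}f_rD_r \;\Big|\; f_r\in\mathfrak A(m,n;\underline t)\Big\}$$ be the generalized Witt superalgebra, and let $\mathcal W=W(m,n;\underline t)_{\bar 0}$ be its even part, which is a Lie algebra under the commutator. Then, as vector spaces, $$\operatorname{Der}(\mathcal W)=\operatorname{ad}\mathcal W\;\oplus\;\operatorname{span}_{\mathbb F}\big\{(\operatorname{ad}D_i)^{p^{r_i}} \;\big|\; 1\le i\le m,\ 1\le r_i<t_i\big\}.$$ -/

import Mathlib

namespace WittSuper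

/-- The index set `Y = Y₀ ∪ Y₁` of the variables: `Sum.inl i` (for `i : Fin m`) is an even index,
`Sum.inr k` (for `k : Fin n`) is an odd index. -/
abbrev Y (m n : ℕ) : Type := Fin m ⊕ Fin n

/-- Labels `(α, u)` of the standard basis elements `x^(α) x^u`; here `u = {i₁ < ⋯ < i_k}` stands for
the ordered product `x^u = x_{i₁} ⋯ x_{i_k}` of odd variables. -/
abbrev Idx (m n : ℕ) : Type := (Fin m → ℕ) × Finset (Fin n)

/-- The vector space underlying the superalgebra `𝔄(m,n) = 𝔄(m) ⊗ Λ(n)`, the tensor product of the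
divided power algebra in `m` variables and the exterior algebra in `n` variables: it has the basis
`x^(α) x^u`. Its multiplication is `WittSuper.mul` below. -/
abbrev A (F : Type*) [Field F] (m n : ℕ) : Type _ := Idx m n →₀ F

/-- The parity of an index. -/
def tau {m n : ℕ} : Y m n → ZMod 2
  | Sum.inl _ => 0
  | Sum.inr _ => 1

section Algebra

variable (F : Type*) [Field F] {m n : ℕ}

/-- The sign that sorts the product `x^u x^v` of odd monomials: one factor `-1` for each pair
`(i, j) ∈ u × v` with `j < i`. -/
def sgn (u v : Finset (Fin n)) : F := ∏ i ∈ u, ∏ j ∈ v, if j < i then -1 else 1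

/-- The product of binomial coefficients `∏ᵢ (αᵢ + βᵢ choose αᵢ)`, in `F`. -/
def binom (α β : Fin m → ℕ) : F := ∏ i, ((α i + β i).choose (α i) : F)

/-- The product of two basis elements:
`x^(α) x^u ⬝ x^(β) x^v = ± (α + β choose α) x^(α + β) x^(u ∪ v)` if `u`, `v` are disjoint, with the
sorting sign, and `0` otherwise. -/
noncomputable def mulBasis (a b : Idx m n) : A F m n :=
  if Disjoint a.2 b.2 then Finsupp.single (a.1 + b.1, a.2 ∪ b.2) (binom F a.1 b.1 * sgn F a.2 b.2)
  else 0

/-- The multiplication of `𝔄(m,n)`. -/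
noncomputable def mul : A F m n →ₗ[F] A F m n →ₗ[F] A F m n :=
  Finsupp.linearCombination F fun a => Finsupp.linearCombination F fun b => mulBasis F a b

/-- The value of `D_r` on a basis element: `D_i (x^(α) x^u) = x^(α - ε_i) x^u` for an even index `i`
(`0` if `α_i = 0`), and `D_k (x^(α) x^u) = x^(α) ∂x^u/∂x_k` for an odd index `k`. The sign of
`∂x^u/∂x_k = ± x^(u ∖ {k})` is that of `x^u = ± x_k x^(u ∖ {k})`. -/
noncomputable def DBasis : Y m n → Idx m n → A F m n
  | Sum.inl i, a => if a.1 i = 0 then 0 else Finsupp.single (a.1 - Pi.single i 1, a.2) 1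
  | Sum.inr k, a =>
      if k ∈ a.2 then Finsupp.single (a.1, a.2.erase k) (sgn F {k} (a.2.erase k)) else 0

/-- The superderivations `D_r`, `r ∈ Y`, of `𝔄(m,n)`. -/
noncomputable def D (r : Y m n) : Module.End F (A F m n) :=
  Finsupp.linearCombination F (DBasis F r)

/-- The homogeneous part of `𝔄(m,n)` of parity `θ`. -/
def parityPart (m n : ℕ) (θ : ZMod 2) : Submodule F (A F m n) :=
  Finsupp.supported F F {a | (a.2.card : ZMod 2) = θ}

/-- The subspace `𝔄(m,n;t)`, spanned by the `x^(α) x^u` with `α_i ≤ p^(t_i) - 1` for all `i`. -/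
def truncated (n p : ℕ) (t : Fin m → ℕ) : Submodule F (A F m n) :=
  Finsupp.supported F F {a | ∀ i, a.1 i < p ^ t i}

/-- The linear map `(f_r)_r ↦ ∑_r f_r D_r`, where `(f D) (h) = f ⬝ D h`. -/
noncomputable def vectorField : (Y m n → A F m n) →ₗ[F] Module.End F (A F m n) :=
  ∑ r, (LinearMap.lcomp F (A F m n) (D F r)) ∘ₗ (mul F) ∘ₗ (LinearMap.proj r)

/-- The generalized Witt superalgebra `W(m,n;t) = {∑_r f_r D_r | f_r ∈ 𝔄(m,n;t)}`, as a space of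
operators on `𝔄(m,n)`. -/
noncomputable def W (n p : ℕ) (t : Fin m → ℕ) : Submodule F (Module.End F (A F m n)) :=
  (Submodule.pi Set.univ fun _ => truncated F n p t).map (vectorField F)

/-- The even (that is, parity preserving) operators on `𝔄(m,n)`. -/
def evenEnd (m n : ℕ) : Submodule F (Module.End F (A F m n)) where
  carrier := {φ | ∀ θ, ∀ x ∈ parityPart F m n θ, φ x ∈ parityPart F m n θ}
  add_mem' ha hb θ x hx := add_mem (ha θ x hx) (hb θ x hx)
  zero_mem' _ _ _ := zero_mem _
  smul_mem' c _ ha θ x hx := Submodule.smul_mem _ c (ha θ x hx)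

end Algebra

section Facts

variable {F : Type*} [Field F] {m n : ℕ}

theorem vectorField_apply (f : Y m n → A F m n) (h : A F m n) :
    vectorField F f h = ∑ r, mul F (f r) (D F r h) := by
  simp [vectorField, LinearMap.sum_apply]

theorem sgn_union_left {u v : Finset (Fin n)} (h : Disjoint u v) (w : Finset (Fin n)) :
    sgn F (u ∪ v) w = sgn F u w * sgn F v w := by
  simp [sgn, Finset.prod_union h]

theorem sgn_union_right (w : Finset (Fin n)) {u v : Finset (Fin n)} (h : Disjoint u v) :
    sgn F w (u ∪ v) = sgn F w u * sgn F w v := by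
  simp [sgn, Finset.prod_union h, Finset.prod_mul_distrib]

theorem sgn_comm {u v : Finset (Fin n)} (h : Disjoint u v) :
    sgn F u v = (-1) ^ (u.card * v.card) * sgn F v u := by
  have h1 : sgn F u v * sgn F v u = (-1) ^ (u.card * v.card) := by
    unfold sgn
    rw [Finset.prod_comm (s := v) (t := u), ← Finset.prod_mul_distrib]
    simp only [← Finset.prod_mul_distrib]
    have : ∀ i ∈ u, (∏ j ∈ v, ((if j < i then (-1 : F) else 1) * if i < j then -1 else 1))
        = (-1) ^ v.card := by
      intro i hi
      rw [Finset.prod_congr rfl (g := fun _ => (-1 : F)), Finset.prod_const]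
      intro j hj
      have hne : i ≠ j := fun e => Finset.disjoint_left.1 h hi (e ▸ hj)
      rcases lt_or_gt_of_ne hne with h | h <;> simp [h, h.not_gt]
    rw [Finset.prod_congr rfl this, Finset.prod_const, ← pow_mul, mul_comm]
  have h2 : sgn F v u * sgn F v u = 1 := by
    unfold sgn
    simp only [← Finset.prod_mul_distrib]
    refine Finset.prod_eq_one fun i _ => Finset.prod_eq_one fun j _ => ?_
    split_ifs <;> simp
  rw [← h1, mul_assoc, h2, mul_one]

theorem mul_single (a b : Idx m n) (c d : F) :
    mul F (Finsupp.single a c) (Finsupp.single b d) = (c * d) • mulBasis F a b := by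
  simp [mul, smul_smul]

theorem D_single (r : Y m n) (a : Idx m n) (c : F) :
    D F r (Finsupp.single a c) = c • DBasis F r a := by
  simp [D]

theorem binom_comm (α β : Fin m → ℕ) : binom F α β = binom F β α := by
  unfold binom
  refine Finset.prod_congr rfl fun i _ => ?_
  rw [add_comm (β i), Nat.choose_symm_add]

theorem binom_assoc (α β γ : Fin m → ℕ) :
    binom F α β * binom F (α + β) γ = binom F β γ * binom F α (β + γ) := by
  unfold binom
  rw [← Finset.prod_mul_distrib, ← Finset.prod_mul_distrib]
  refine Finset.prod_congr rfl fun i _ => ?_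
  simp only [Pi.add_apply]
  norm_cast
  have h := Nat.choose_mul (n := α i + β i + γ i) (k := α i + β i) (s := α i) (by omega)
  rw [show α i + β i + γ i - α i = β i + γ i by omega, show α i + β i - α i = β i by omega] at h
  rw [mul_comm, h, mul_comm, add_assoc]

theorem mul_assoc' (f g h : A F m n) : mul F (mul F f g) h = mul F f (mul F g h) := by
  induction f using Finsupp.induction_linear with
  | zero => simp
  | add f f' hf hf' => simp [hf, hf']
  | single a x =>
  induction g using Finsupp.induction_linear with
  | zero => simp
  | add f f' hf hf' => simp [hf, hf']
  | single b y =>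
  induction h using Finsupp.induction_linear with
  | zero => simp
  | add f f' hf hf' => simp [hf, hf']
  | single c z =>
  rw [mul_single, mul_single]
  unfold mulBasis
  by_cases hab : Disjoint a.2 b.2
  · by_cases hbc : Disjoint b.2 c.2
    · simp only [hab, hbc, if_true, Finsupp.smul_single, mul_single]
      unfold mulBasis
      by_cases hac : Disjoint a.2 c.2
      · rw [if_pos (by simp [Finset.disjoint_union_left, hac, hbc]),
          if_pos (by simp [Finset.disjoint_union_right, hac, hab])]
        simp only [Finsupp.smul_single, smul_eq_mul, sgn_union_left hab, sgn_union_right _ hbc,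
          add_assoc, Finset.union_assoc]
        congr 1
        linear_combination (x * y * z * sgn F a.2 b.2 * sgn F a.2 c.2 * sgn F b.2 c.2) *
          binom_assoc (F := F) a.1 b.1 c.1
      · rw [if_neg (by simp [Finset.disjoint_union_left, hac]),
          if_neg (by simp [Finset.disjoint_union_right, hac])]
        simp
    · simp only [hab, hbc, if_true, if_false, Finsupp.smul_single, mul_single, smul_zero, map_zero]
      unfold mulBasis
      rw [if_neg (by simp [Finset.disjoint_union_left, hbc]), smul_zero]
  · by_cases hbc : Disjoint b.2 c.2
    · simp only [hab, hbc, if_true, if_false, Finsupp.smul_single, mul_single, smul_zero, map_zero]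
      unfold mulBasis
      rw [if_neg (by simp [Finset.disjoint_union_right, hab]), smul_zero]
      simp
    · simp [hab, hbc]

/-- The sign `(-1)^(θ μ)` for parities `θ`, `μ`. -/
def koszul (F : Type*) [Field F] (θ μ : ZMod 2) : F := if θ = 1 ∧ μ = 1 then -1 else 1

theorem koszul_natCast (a b : ℕ) : koszul F (a : ZMod 2) (b : ZMod 2) = (-1) ^ (a * b) := by
  have key : ∀ a : ℕ, (a : ZMod 2) = 1 ↔ Odd a := fun a => ZMod.natCast_eq_one_iff_odd
  unfold koszul
  simp only [key]
  split_ifs with h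
  · exact ((h.1.mul h.2).neg_one_pow).symm
  · rw [← Nat.odd_mul, Nat.not_odd_iff_even] at h
    exact h.neg_one_pow.symm

theorem koszul_mul_self (θ μ : ZMod 2) : koszul F θ μ * koszul F θ μ = 1 := by
  unfold koszul; split_ifs <;> simp

theorem koszul_comm (θ μ : ZMod 2) : koszul F θ μ = koszul F μ θ := by
  simp [koszul, and_comm]

theorem parityPart_induction {θ : ZMod 2} {P : A F m n → Prop}
    (h0 : P 0) (hadd : ∀ f g, P f → P g → P (f + g))
    (hs : ∀ (a : Idx m n) (c : F), (a.2.card : ZMod 2) = θ → P (Finsupp.single a c))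
    {f : A F m n} (hf : f ∈ parityPart F m n θ) : P f := by
  rw [parityPart, Finsupp.supported_eq_span_single] at hf
  induction hf using Submodule.closure_induction with
  | zero => exact h0
  | add x y _ _ hx hy => exact hadd x y hx hy
  | smul_mem c x hx =>
    obtain ⟨a, ha, rfl⟩ := hx
    rw [Finsupp.smul_single]
    exact hs a _ ha

theorem mul_supercomm {θ μ : ZMod 2} {f g : A F m n}
    (hf : f ∈ parityPart F m n θ) (hg : g ∈ parityPart F m n μ) :
    mul F f g = koszul F θ μ • mul F g f := by
  refine parityPart_induction (P := fun f => mul F f g = koszul F θ μ • mul F g f) (by simp)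
    (fun f f' h h' => by simp [h, h']) (fun a x ha => ?_) hf
  refine parityPart_induction
    (P := fun g => mul F (Finsupp.single a x) g = koszul F θ μ • mul F g (Finsupp.single a x))
    (by simp) (fun f f' h h' => by simp [h, h']) (fun b y hb => ?_) hg
  rw [← ha, ← hb, koszul_natCast, mul_single, mul_single]
  unfold mulBasis
  by_cases hab : Disjoint a.2 b.2
  · rw [if_pos hab, if_pos hab.symm, sgn_comm hab, binom_comm a.1, add_comm a.1, Finset.union_comm]
    simp only [Finsupp.smul_single, smul_eq_mul]
    congr 1
    ring
  · rw [if_neg hab, if_neg fun h => hab h.symm]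
    simp

theorem sgn_sq (u v : Finset (Fin n)) : sgn F u v * sgn F u v = 1 := by
  unfold sgn
  simp only [← Finset.prod_mul_distrib]
  refine Finset.prod_eq_one fun i _ => Finset.prod_eq_one fun j _ => ?_
  split_ifs <;> simp

theorem prod_eq_single_mul (G : Fin m → F) (i : Fin m) :
    ∏ j, G j = G i * ∏ j ∈ Finset.univ.erase i, G j :=
  (Finset.mul_prod_erase _ _ (Finset.mem_univ i)).symm

theorem binom_sub_left (α β : Fin m → ℕ) (i : Fin m) (h : α i ≠ 0) :
    binom F (α - Pi.single i 1) β =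
      ((α i + β i - 1).choose (α i - 1) : F) *
        ∏ j ∈ Finset.univ.erase i, ((α j + β j).choose (α j) : F) := by
  unfold binom
  rw [prod_eq_single_mul _ i]
  congr 1
  · simp only [Pi.sub_apply, Pi.single_eq_same]
    rw [show α i - 1 + β i = α i + β i - 1 by omega]
  · refine Finset.prod_congr rfl fun j hj => ?_
    have : j ≠ i := Finset.ne_of_mem_erase hj
    simp [this]

theorem binom_sub_right (α β : Fin m → ℕ) (i : Fin m) (h : β i ≠ 0) :
    binom F α (β - Pi.single i 1) =
      ((α i + β i - 1).choose (α i) : F) *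
        ∏ j ∈ Finset.univ.erase i, ((α j + β j).choose (α j) : F) := by
  unfold binom
  rw [prod_eq_single_mul _ i]
  congr 1
  · simp only [Pi.sub_apply, Pi.single_eq_same]
    rw [show α i + (β i - 1) = α i + β i - 1 by omega]
  · refine Finset.prod_congr rfl fun j hj => ?_
    have : j ≠ i := Finset.ne_of_mem_erase hj
    simp [this]

theorem sub_single_add (α β : Fin m → ℕ) (i : Fin m) (h : α i ≠ 0) :
    α - Pi.single i 1 + β = α + β - Pi.single i 1 := by
  funext j
  by_cases hj : j = i
  · subst hj; simp; omega
  · simp [hj]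

theorem D_inl_mul (i : Fin m) (f g : A F m n) :
    D F (Sum.inl i) (mul F f g) = mul F (D F (Sum.inl i) f) g + mul F f (D F (Sum.inl i) g) := by
  induction f using Finsupp.induction_linear with
  | zero => simp
  | add f f' hf hf' => simp only [map_add, LinearMap.add_apply, hf, hf']; abel
  | single a x =>
  induction g using Finsupp.induction_linear with
  | zero => simp
  | add f f' hf hf' => simp only [map_add, hf, hf']; abel
  | single b y =>
  obtain ⟨α, u⟩ := a
  obtain ⟨β, v⟩ := b
  rw [mul_single, D_single, D_single, map_smul, map_smul, map_smul, LinearMap.smul_apply]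
  by_cases huv : Disjoint u v
  · simp only [mulBasis, huv, if_true, D_single, DBasis]
    by_cases ha : α i = 0
    · by_cases hb : β i = 0
      · simp [ha, hb]
      · have hs : α + (β - Pi.single i 1) = α + β - Pi.single i 1 := by
          rw [add_comm, sub_single_add _ _ _ hb, add_comm]
        rw [if_neg (by simp [ha, hb]), if_pos ha, if_neg hb]
        simp only [map_zero, LinearMap.zero_apply, smul_zero, zero_add, mul_single]
        simp only [mulBasis, huv, if_true, Finsupp.smul_single, smul_eq_mul, hs, mul_one]
        congr 1
        rw [binom_sub_right _ _ _ hb, binom, prod_eq_single_mul _ i]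
        simp [ha]
        ring
    · by_cases hb : β i = 0
      · rw [if_neg (by simp [ha]), if_pos hb, if_neg ha]
        simp only [map_zero, smul_zero, add_zero, mul_single]
        simp only [mulBasis, huv, if_true, Finsupp.smul_single, smul_eq_mul,
          sub_single_add _ _ _ ha, mul_one]
        congr 1
        rw [binom_sub_left _ _ _ ha, binom, prod_eq_single_mul _ i]
        simp [hb]
        ring
      · have hs : α + (β - Pi.single i 1) = α + β - Pi.single i 1 := by
          rw [add_comm, sub_single_add _ _ _ hb, add_comm]
        rw [if_neg (by simp [ha]), if_neg hb, if_neg ha]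
        simp only [mul_single]
        simp only [mulBasis, huv, if_true, Finsupp.smul_single, smul_eq_mul,
          sub_single_add _ _ _ ha, hs, mul_one, ← Finsupp.single_add]
        congr 1
        rw [binom_sub_left _ _ _ ha, binom_sub_right _ _ _ hb, binom, prod_eq_single_mul _ i]
        have hp : ((α i + β i).choose (α i) : F) =
            ((α i + β i - 1).choose (α i - 1) : F) + ((α i + β i - 1).choose (α i) : F) := by
          obtain ⟨a, ha'⟩ := Nat.exists_eq_succ_of_ne_zero ha
          rw [ha', show a.succ + β i = (a + β i) + 1 by omega, Nat.succ_eq_add_one,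
            Nat.choose_succ_succ]
          simp
        rw [hp]
        ring
  · simp only [mulBasis, huv, if_false, DBasis, smul_zero, map_zero]
    split_ifs <;> simp [mul_single, mulBasis, huv]

theorem sgn_erase_left {u : Finset (Fin n)} {k : Fin n} (hk : k ∈ u) (v : Finset (Fin n)) :
    sgn F u v = sgn F {k} v * sgn F (u.erase k) v := by
  rw [← sgn_union_left (by simp), ← Finset.insert_eq, Finset.insert_erase hk]

theorem sgn_erase_right {u : Finset (Fin n)} {k : Fin n} (hk : k ∈ u) (v : Finset (Fin n)) :
    sgn F v u = sgn F v {k} * sgn F v (u.erase k) := by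
  rw [← sgn_union_right _ (by simp), ← Finset.insert_eq, Finset.insert_erase hk]

theorem D_inr_single_mul (k : Fin n) (a b : Idx m n) (x y : F) :
    D F (Sum.inr k) (mul F (Finsupp.single a x) (Finsupp.single b y)) =
      mul F (D F (Sum.inr k) (Finsupp.single a x)) (Finsupp.single b y) +
        (-1 : F) ^ a.2.card •
          mul F (Finsupp.single a x) (D F (Sum.inr k) (Finsupp.single b y)) := by
  obtain ⟨α, u⟩ := a
  obtain ⟨β, v⟩ := b
  rw [mul_single, D_single, D_single, map_smul, map_smul, map_smul, LinearMap.smul_apply]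
  by_cases huv : Disjoint u v
  · simp only [mulBasis, huv, if_true, D_single, DBasis]
    by_cases hu : k ∈ u
    · have hv : k ∉ v := Finset.disjoint_left.1 huv hu
      have hd : Disjoint (u.erase k) v := huv.mono_left (Finset.erase_subset _ _)
      have he : (u ∪ v).erase k = u.erase k ∪ v := by
        rw [Finset.erase_union_distrib, Finset.erase_eq_of_notMem hv]
      rw [if_pos (Finset.mem_union_left _ hu), if_pos hu, if_neg hv]
      simp only [map_zero, smul_zero, add_zero, mul_single, mulBasis, hd, if_true,
        Finsupp.smul_single, smul_eq_mul, he]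
      congr 1
      rw [sgn_union_right _ hd, sgn_erase_left hu v]
      linear_combination (x * y * binom F α β * sgn F {k} (u.erase k) * sgn F (u.erase k) v) *
        sgn_sq (F := F) {k} v
    · by_cases hv : k ∈ v
      · have hd : Disjoint u (v.erase k) := huv.mono_right (Finset.erase_subset _ _)
        have he : (u ∪ v).erase k = u ∪ v.erase k := by
          rw [Finset.erase_union_distrib, Finset.erase_eq_of_notMem hu]
        rw [if_pos (Finset.mem_union_right _ hv), if_neg hu, if_pos hv]
        simp only [map_zero, smul_zero, zero_add, mul_single, mulBasis, hd, if_true,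
          Finsupp.smul_single, smul_eq_mul, he, LinearMap.zero_apply]
        congr 1
        rw [sgn_union_right _ hd, sgn_erase_right hv u,
          sgn_comm (u := u) (v := {k}) (by simpa using hu), Finset.card_singleton, mul_one]
        linear_combination (x * y * binom F α β * sgn F {k} (v.erase k) * sgn F u (v.erase k) *
          (-1) ^ u.card) * sgn_sq (F := F) {k} u
      · rw [if_neg (by simp [hu, hv]), if_neg hu, if_neg hv]
        simp
  · simp only [mulBasis, huv, if_false, DBasis, smul_zero, map_zero]
    by_cases hd : Disjoint (u.erase k) (v.erase k)
    · have hk : k ∈ u ∧ k ∈ v := by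
        rw [Finset.not_disjoint_iff] at huv
        obtain ⟨j, hju, hjv⟩ := huv
        by_cases hjk : j = k
        · exact hjk ▸ ⟨hju, hjv⟩
        · exact absurd (Finset.mem_erase.2 ⟨hjk, hjv⟩)
            (Finset.disjoint_left.1 hd (Finset.mem_erase.2 ⟨hjk, hju⟩))
      obtain ⟨hu, hv⟩ := hk
      have h1 : Disjoint (u.erase k) v := by
        rw [← Finset.insert_erase hv, Finset.disjoint_insert_right]; simp [hd]
      have h2 : Disjoint u (v.erase k) := by
        rw [← Finset.insert_erase hu, Finset.disjoint_insert_left]; simp [hd]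
      have he : u.erase k ∪ v = u ∪ v.erase k := by
        ext j; by_cases hj : j = k <;> simp [hj, hu, hv]
      have hc : u.card = (u.erase k).card + 1 := (Finset.card_erase_add_one hu).symm
      rw [if_pos hu, if_pos hv, mul_single, mul_single]
      simp only [mulBasis, h1, h2, if_true, Finsupp.smul_single, smul_eq_mul, he,
        ← Finsupp.single_add]
      rw [eq_comm, Finsupp.single_eq_zero, sgn_erase_right hv (u.erase k), sgn_erase_left hu,
        sgn_comm (u := u.erase k) (v := {k}) (by simp), Finset.card_singleton, mul_one, hc,
        pow_succ]
      linear_combination (x * y * binom F α β * sgn F (u.erase k) (v.erase k) *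
        (-1) ^ (u.erase k).card) *
          (sgn_sq (F := F) {k} (u.erase k) - sgn_sq (F := F) {k} (v.erase k))
    · have h1 : ¬ Disjoint (u.erase k) v := fun h => hd (h.mono_right (Finset.erase_subset _ _))
      have h2 : ¬ Disjoint u (v.erase k) := fun h => hd (h.mono_left (Finset.erase_subset _ _))
      split_ifs <;> simp [mul_single, mulBasis, h1, h2]

/-- `D_r` is a superderivation of `𝔄(m,n)` of parity `τ(r)`. -/
theorem D_mul (r : Y m n) {θ : ZMod 2} {f : A F m n} (hf : f ∈ parityPart F m n θ) (g : A F m n) :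
    D F r (mul F f g) = mul F (D F r f) g + koszul F (tau r) θ • mul F f (D F r g) := by
  cases r with
  | inl i => simp [tau, koszul, D_inl_mul]
  | inr k =>
    refine parityPart_induction (P := fun f => D F (Sum.inr k) (mul F f g) =
      mul F (D F (Sum.inr k) f) g + koszul F (tau (Sum.inr k : Y m n)) θ •
        mul F f (D F (Sum.inr k) g)) (by simp) (fun f f' h h' => ?_) (fun a x ha => ?_) hf
    · simp only [map_add, LinearMap.add_apply, h, h', smul_add]; abel
    · induction g using Finsupp.induction_linear with
      | zero => simp
      | add f f' hf hf' => simp only [map_add, hf, hf', smul_add]; abel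
      | single b y =>
        rw [D_inr_single_mul, ← ha]
        have := koszul_natCast (F := F) 1 a.2.card
        rw [Nat.cast_one, one_mul] at this
        rw [tau, this]

theorem D_comm (r s : Y m n) (h : A F m n) :
    D F r (D F s h) = koszul F (tau r) (tau s) • D F s (D F r h) := by
  induction h using Finsupp.induction_linear with
  | zero => simp
  | add f f' hf hf' => simp [hf, hf']
  | single a x =>
  obtain ⟨α, u⟩ := a
  rw [D_single, D_single, map_smul, map_smul, smul_comm]
  congr 1
  rcases r with i | k <;> rcases s with j | l
  · by_cases hij : i = j
    · subst hij; simp [koszul, tau]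
    · simp only [DBasis, koszul, tau]
      by_cases hi : α i = 0 <;> by_cases hj : α j = 0 <;>
        simp [hi, hj, D_single, DBasis, hij, Ne.symm hij, tsub_right_comm]
  · by_cases hi : α i = 0 <;> by_cases hj : l ∈ u <;>
      simp [DBasis, koszul, tau, hi, hj, D_single]
  · by_cases hi : α j = 0 <;> by_cases hj : k ∈ u <;>
      simp [DBasis, koszul, tau, hi, hj, D_single]
  · by_cases hkl : k = l
    · subst hkl
      by_cases hk : k ∈ u <;> simp [DBasis, hk, D_single]
    · by_cases hk : k ∈ u <;> by_cases hl : l ∈ u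
      · simp only [DBasis, hk, hl, if_true, D_single, Finset.mem_erase, ne_eq, hkl, Ne.symm hkl,
          not_false_eq_true, and_self, Finsupp.smul_single, smul_eq_mul, Finset.erase_right_comm,
          koszul, tau]
        congr 1
        have hk' : k ∈ u.erase l := Finset.mem_erase.2 ⟨hkl, hk⟩
        have hl' : l ∈ u.erase k := Finset.mem_erase.2 ⟨Ne.symm hkl, hl⟩
        rw [sgn_erase_right hk' {l}, sgn_erase_right hl' {k}, Finset.erase_right_comm,
          sgn_comm (u := {l}) (v := {k}) (by simpa using Ne.symm hkl)]
        simp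
        ring
      all_goals simp [DBasis, hk, hl, D_single]

theorem mul_mem_parityPart {θ μ : ZMod 2} {f g : A F m n}
    (hf : f ∈ parityPart F m n θ) (hg : g ∈ parityPart F m n μ) :
    mul F f g ∈ parityPart F m n (θ + μ) := by
  refine parityPart_induction (P := fun f => mul F f g ∈ parityPart F m n (θ + μ)) (by simp)
    (fun f f' h h' => by simpa using add_mem h h') (fun a x ha => ?_) hf
  refine parityPart_induction
    (P := fun g => mul F (Finsupp.single a x) g ∈ parityPart F m n (θ + μ)) (by simp)
    (fun f f' h h' => by simpa using add_mem h h') (fun b y hb => ?_) hg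
  rw [mul_single, mulBasis]
  split_ifs with hd
  · refine Submodule.smul_mem _ _ (Finsupp.single_mem_supported F _ ?_)
    simp [Finset.card_union_of_disjoint hd, ← ha, ← hb]
  · simp

theorem D_mem_parityPart (r : Y m n) {θ : ZMod 2} {f : A F m n} (hf : f ∈ parityPart F m n θ) :
    D F r f ∈ parityPart F m n (tau r + θ) := by
  refine parityPart_induction (P := fun f => D F r f ∈ parityPart F m n (tau r + θ)) (by simp)
    (fun f f' h h' => by simpa using add_mem h h') (fun a x ha => ?_) hf
  rw [D_single]
  refine Submodule.smul_mem _ _ ?_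
  rcases r with i | k
  · simp only [DBasis]
    split_ifs
    · simp
    · exact Finsupp.single_mem_supported F _ (by simp [tau, ha])
  · simp only [DBasis]
    split_ifs with hk
    · refine Finsupp.single_mem_supported F _ ?_
      rw [← Finset.card_erase_add_one hk] at ha
      simp only [Set.mem_ofPred_eq, tau, ← ha]
      push_cast
      rw [add_comm, add_assoc, show (1 : ZMod 2) + 1 = 0 by decide, add_zero]
    · simp

theorem truncated_induction {p : ℕ} {t : Fin m → ℕ} {P : A F m n → Prop}
    (h0 : P 0) (hadd : ∀ f g, P f → P g → P (f + g))
    (hs : ∀ (a : Idx m n) (c : F), (∀ i, a.1 i < p ^ t i) → P (Finsupp.single a c))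
    {f : A F m n} (hf : f ∈ truncated F n p t) : P f := by
  rw [truncated, Finsupp.supported_eq_span_single] at hf
  induction hf using Submodule.closure_induction with
  | zero => exact h0
  | add x y _ _ hx hy => exact hadd x y hx hy
  | smul_mem c x hx =>
    obtain ⟨a, ha, rfl⟩ := hx
    rw [Finsupp.smul_single]
    exact hs a _ ha

theorem D_mem_truncated {p : ℕ} {t : Fin m → ℕ} (r : Y m n) {f : A F m n}
    (hf : f ∈ truncated F n p t) : D F r f ∈ truncated F n p t := by
  refine truncated_induction (P := fun f => D F r f ∈ truncated F n p t) (by simp)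
    (fun f f' h h' => by simpa using add_mem h h') (fun a x ha => ?_) hf
  rw [D_single]
  refine Submodule.smul_mem _ _ ?_
  rcases r with i | k
  · simp only [DBasis]
    split_ifs
    · simp
    · exact Finsupp.single_mem_supported F _ fun j => lt_of_le_of_lt (Nat.sub_le _ _) (ha j)
  · simp only [DBasis]
    split_ifs with hk
    · exact Finsupp.single_mem_supported F _ ha
    · simp

theorem choose_cast_eq_zero (p : ℕ) [Fact p.Prime] [CharP F p] {a b t : ℕ}
    (ha : a < p ^ t) (hb : b < p ^ t) (hab : p ^ t ≤ a + b) : ((a + b).choose a : F) = 0 := by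
  have hp : p.Prime := Fact.out
  rw [CharP.cast_eq_zero_iff F p]
  have h := Nat.factorization_choose' (p := p) (n := b) (k := a)
    (b := max (Nat.log p (b + a) + 1) (t + 1)) hp (by omega)
  have ht : t ≠ 0 := by rintro rfl; simp at ha hb hab; omega
  have hmem : t ∈ (Finset.Ico 1 (max (Nat.log p (b + a) + 1) (t + 1))).filter
      fun i => p ^ i ≤ a % p ^ i + b % p ^ i := by
    simp only [Finset.mem_filter, Finset.mem_Ico]
    rw [Nat.mod_eq_of_lt ha, Nat.mod_eq_of_lt hb]
    omega
  rw [add_comm a b]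
  refine Nat.dvd_of_factorization_pos ?_
  rw [h]
  exact Finset.card_ne_zero_of_mem hmem

/-- `𝔄(m,n;t)` is closed under multiplication. -/
theorem mul_mem_truncated {p : ℕ} [Fact p.Prime] [CharP F p] {t : Fin m → ℕ} {f g : A F m n}
    (hf : f ∈ truncated F n p t) (hg : g ∈ truncated F n p t) : mul F f g ∈ truncated F n p t := by
  refine truncated_induction (P := fun f => mul F f g ∈ truncated F n p t) (by simp)
    (fun f f' h h' => by simpa using add_mem h h') (fun a x ha => ?_) hf
  refine truncated_induction (P := fun g => mul F (Finsupp.single a x) g ∈ truncated F n p t)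
    (by simp) (fun f f' h h' => by simpa using add_mem h h') (fun b y hb => ?_) hg
  rw [mul_single, mulBasis]
  refine Submodule.smul_mem _ _ ?_
  split_ifs with hd
  · by_cases h : ∀ i, a.1 i + b.1 i < p ^ t i
    · exact Finsupp.single_mem_supported F _ h
    · push Not at h
      obtain ⟨i, hi⟩ := h
      have : binom F a.1 b.1 = 0 :=
        Finset.prod_eq_zero (Finset.mem_univ i) (choose_cast_eq_zero p (ha i) (hb i) hi)
      simp [this]
  · simp

/-- The unit of `𝔄(m,n)`. -/
noncomputable def one : A F m n := Finsupp.single (0, ∅) 1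

/-- The variable `x_r`. -/
noncomputable def X : Y m n → A F m n
  | Sum.inl i => Finsupp.single (Pi.single i 1, ∅) 1
  | Sum.inr k => Finsupp.single (0, {k}) 1

theorem mul_one' (f : A F m n) : mul F f one = f := by
  induction f using Finsupp.induction_linear with
  | zero => simp
  | add f f' hf hf' => simp [hf, hf']
  | single a x => simp [one, mul_single, mulBasis, binom, sgn]

theorem one_mul' (f : A F m n) : mul F one f = f := by
  induction f using Finsupp.induction_linear with
  | zero => simp
  | add f f' hf hf' => simp [hf, hf']
  | single a x => simp [one, mul_single, mulBasis, binom, sgn]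

theorem D_X (r s : Y m n) : D F r (X s) = if r = s then one else 0 := by
  rcases r with i | k <;> rcases s with j | l
  · by_cases h : i = j
    · subst h; simp [X, D_single, DBasis, one]
    · simp [X, D_single, DBasis, h]
  · simp [X, D_single, DBasis]
  · simp [X, D_single, DBasis]
  · by_cases h : k = l
    · subst h; simp [X, D_single, DBasis, one, sgn]
    · simp [X, D_single, DBasis, h]

theorem X_mem_parityPart (r : Y m n) : X r ∈ parityPart F m n (tau r) := by
  rcases r with i | k <;> exact Finsupp.single_mem_supported F _ (by simp [tau])

theorem vectorField_X (f : Y m n → A F m n) (r : Y m n) : vectorField F f (X r) = f r := by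
  rw [vectorField_apply, Finset.sum_eq_single r]
  · simp [D_X, mul_one']
  · intro s _ hs; simp [D_X, hs]
  · simp

/-- The commutator of even elements of `W(m,n)`, in coordinates. -/
theorem vectorField_lie {f g : Y m n → A F m n} (hf : ∀ r, f r ∈ parityPart F m n (tau r))
    (hg : ∀ r, g r ∈ parityPart F m n (tau r)) :
    vectorField F f * vectorField F g - vectorField F g * vectorField F f =
      vectorField F (fun s => ∑ r, (mul F (f r) (D F r (g s)) - mul F (g r) (D F r (f s)))) := by
  have key : ∀ {f g : Y m n → A F m n}, (∀ r, g r ∈ parityPart F m n (tau r)) → ∀ h,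
      vectorField F f (vectorField F g h) =
        ∑ r, ∑ s, mul F (mul F (f r) (D F r (g s))) (D F s h) +
        ∑ r, ∑ s, koszul F (tau r) (tau s) • mul F (mul F (f r) (g s)) (D F r (D F s h)) := by
    intro f g hg h
    simp only [vectorField_apply, map_sum, ← Finset.sum_add_distrib]
    rw [Finset.sum_comm]
    refine Finset.sum_congr rfl fun r _ => Finset.sum_congr rfl fun s _ => ?_
    rw [D_mul r (hg s), map_add, map_smul, mul_assoc', mul_assoc']
  have sym : ∀ h, ∑ r, ∑ s, koszul F (tau r) (tau s) • mul F (mul F (f r) (g s)) (D F r (D F s h))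
      = ∑ r, ∑ s, koszul F (tau r) (tau s) • mul F (mul F (g r) (f s)) (D F r (D F s h)) := by
    intro h
    rw [Finset.sum_comm]
    refine Finset.sum_congr rfl fun s _ => Finset.sum_congr rfl fun r _ => ?_
    rw [mul_supercomm (hf r) (hg s), D_comm r s, koszul_comm (tau s) (tau r)]
    simp only [map_smul, LinearMap.smul_apply, smul_smul]
    rw [koszul_mul_self, mul_one]
  refine LinearMap.ext fun h => ?_
  rw [LinearMap.sub_apply, Module.End.mul_apply, Module.End.mul_apply, key hg, key hf,
    sym, add_sub_add_right_eq_sub, vectorField_apply,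
    Finset.sum_comm (f := fun (r s : Y m n) => mul F (mul F (f r) (D F r (g s))) (D F s h)),
    Finset.sum_comm (f := fun (r s : Y m n) => mul F (mul F (g r) (D F r (f s))) (D F s h)),
    ← Finset.sum_sub_distrib]
  refine Finset.sum_congr rfl fun s _ => ?_
  simp only [map_sum, map_sub, LinearMap.sum_apply, LinearMap.sub_apply, Finset.sum_sub_distrib]

theorem mem_W {p : ℕ} {t : Fin m → ℕ} {φ : Module.End F (A F m n)} :
    φ ∈ W F n p t ↔ ∃ f : Y m n → A F m n, (∀ r, f r ∈ truncated F n p t) ∧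
      vectorField F f = φ := by
  simp [W, Submodule.mem_map, Submodule.mem_pi]

end Facts

attribute [local instance] LieRing.ofAssociativeRing

/-- The even part `𝒲` of `W(m,n;t)`, a Lie algebra under the commutator of operators. -/
noncomputable def evenW (F : Type*) [Field F] {m : ℕ} (n p : ℕ) [Fact p.Prime] [CharP F p]
    (t : Fin m → ℕ) : LieSubalgebra F (Module.End F (A F m n)) where
  toSubmodule := W F n p t ⊓ evenEnd F m n
  lie_mem' := by
    rintro φ ψ ⟨hφ, hφe⟩ ⟨hψ, hψe⟩
    refine ⟨?_, fun θ x hx => sub_mem (hφe θ _ (hψe θ x hx)) (hψe θ _ (hφe θ x hx))⟩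
    obtain ⟨f, hf, rfl⟩ := mem_W.1 hφ
    obtain ⟨g, hg, rfl⟩ := mem_W.1 hψ
    have hf' : ∀ r, f r ∈ parityPart F m n (tau r) := fun r => by
      simpa [vectorField_X] using hφe _ _ (X_mem_parityPart r)
    have hg' : ∀ r, g r ∈ parityPart F m n (tau r) := fun r => by
      simpa [vectorField_X] using hψe _ _ (X_mem_parityPart r)
    change vectorField F f * vectorField F g - vectorField F g * vectorField F f ∈ W F n p t
    rw [vectorField_lie hf' hg']
    exact mem_W.2 ⟨_, fun s => Submodule.sum_mem _ fun r _ => sub_mem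
      (mul_mem_truncated (hf r) (D_mem_truncated r (hg s)))
      (mul_mem_truncated (hg r) (D_mem_truncated r (hf s))), rfl⟩

/-- `D_i`, for an even index `i`, as an element of `𝒲`. -/
noncomputable def evenD (F : Type*) [Field F] {m : ℕ} (n p : ℕ) [Fact p.Prime] [CharP F p]
    (t : Fin m → ℕ) (i : Fin m) : evenW F n p t :=
  ⟨D F (Sum.inl i), by
    refine ⟨mem_W.2 ⟨Pi.single (Sum.inl i) one, fun r => ?_, ?_⟩, fun θ x hx => ?_⟩
    · by_cases hr : r = Sum.inl i
      · subst hr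
        rw [Pi.single_eq_same]
        exact Finsupp.single_mem_supported F _ fun j => pow_pos (Fact.out : p.Prime).pos _
      · rw [Pi.single_eq_of_ne hr]
        exact zero_mem _
    · refine LinearMap.ext fun h => ?_
      rw [vectorField_apply, Finset.sum_eq_single (Sum.inl i)]
      · rw [Pi.single_eq_same, one_mul']
      · intro s _ hs; rw [Pi.single_eq_of_ne hs]; simp
      · simp
    · simpa [tau] using D_mem_parityPart (Sum.inl i) hx⟩

end WittSuper

/-!
Write `𝒲` for the even part of `W(m,n;t)`. It has the basis `e r (α, u) = x^(α) x^u D_r`, with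
`α_i < p^(t_i)` and `|u|` of the parity of `D_r`; `coef` reads off coordinates. Two families act
transparently in coordinates: `ad D_i` lowers `α_i` by one (`coef_lie_evenD`), and the torus elements
`h_r = x_r D_r` act diagonally, by the weight `wt` (`coef_lie_torus`). The elements annihilated by all
`ad D_i` are those with constant coefficients; among their weights under the `h_i`, `i ≤ m`, only `0`
and `-1` occur, and only the `h_k` with `k` odd have weight zero for the whole torus. As `n ≥ 3` and
`p > 2`, these are separated by their action on the elements `x_k x_l D_j`, so that `0` is the only
element commuting with all `D_i`, all `h_r` and all `x_k x_l D_j` (`eq_zero_of_lie`). Every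
`(ad D_i)^(p^r)` with `r ≥ 1` vanishes at these elements, which shows that the sum is direct.

Let `φ` be a derivation, and `q = p^(t_i)`. If `[D_i, y] = 0`, then `(ad D_i)^(q-1)` applied to
`[φ(D_i), y] + [D_i, φ(y)] = 0` shows that `c = (ad D_i)^(q-1) φ(D_i)` commutes with `y`; the same
computation with `y = h_i` gives `[c, h_i] = 0`, so `c = 0` (`ad_pow_apply_evenD`). Hence `φ(D_i)` can
be integrated with respect to `x_i`, and, one variable after the other, `φ` is changed by inner
derivations so that it vanishes at all `D_i` (`exists_ad_eq_evenD`). The values at the `h_r` then have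
constant coefficients. Their components of nonzero weight are removed by a further inner derivation,
and the remaining ones vanish by the action on the `x_k x_l D_j` (`exists_ad_eq_torus`). From now on `φ`
preserves weights; it multiplies each `x_k x_l D_j` by a scalar, and this scalar is removed by a
combination of the `h_k` (`exists_ad_eq_pair`).

Subtracting a combination of the `(ad D_i)^(p^r)`, one gets a derivation whose value at each
`x_i^(p^r) D_i` has no component along `D_i` (`IsNormalized`). Such a derivation is zero
(`IsNormalized.eq_zero`). Indeed, if it kills all `[D_i, y]`, where `y` is a basis element, then `φ(y)`
has constant coefficients and the weight of `y`, which leaves few possibilities. For `y = x^(α) D_j`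
these are a multiple of some `D_i` with `i ≠ j`, a combination of the `h_k`, or a multiple of `D_j`. They
are excluded, by induction on `|α|`, by the brackets with `x_i D_j` and with `x_k x_l D_j`, and, in the
last case, by writing `x^(α)` as a product of divided powers of lower degree, which is possible unless
`x^(α) = x_i^(p^r)`. The remaining basis elements are brackets of those already treated, with the
exception of the `x^(α) x^u D_j` of the highest degree in `x_j`: these have weight `-2` under `h_j`,
which does not occur among the elements with constant coefficients.
-/

namespace WittSuper

attribute [local instance] LieRing.ofAssociativeRing

/-! ### Coordinates on the even part -/

section Coordinates

variable {F : Type*} [Field F] {m n : ℕ}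

/-- The label of the variable `x_r` among the basis elements of `𝔄(m,n)`. -/
def xIdx : Y m n → Idx m n
  | Sum.inl i => (Pi.single i 1, ∅)
  | Sum.inr k => (0, {k})

theorem X_eq_single (r : Y m n) : (X r : A F m n) = Finsupp.single (xIdx r) 1 := by
  cases r <;> rfl

/-- The degree of the basis element with label `a` in the variable `x_r`. -/
def degIn : Y m n → Idx m n → ℕ
  | Sum.inl i, a => a.1 i
  | Sum.inr k, a => if k ∈ a.2 then 1 else 0

@[simp] theorem degIn_inl (i : Fin m) (a : Idx m n) : degIn (Sum.inl i) a = a.1 i := rfl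

@[simp] theorem degIn_inr (k : Fin n) (a : Idx m n) :
    degIn (Sum.inr k) a = if k ∈ a.2 then 1 else 0 := rfl

theorem binom_zero_left (β : Fin m → ℕ) : binom F 0 β = 1 := by simp [binom]

theorem binom_zero_right (α : Fin m → ℕ) : binom F α 0 = 1 := by simp [binom]

theorem binom_single_one (i : Fin m) (β : Fin m → ℕ) :
    binom F (Pi.single i 1) β = (β i : F) + 1 := by
  rw [binom, Finset.prod_eq_single i]
  · simp [add_comm]
  · intro j _ hj; simp [hj]
  · simp

theorem sgn_empty_left (v : Finset (Fin n)) : sgn F ∅ v = 1 := by simp [sgn]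

theorem sgn_empty_right (v : Finset (Fin n)) : sgn F v ∅ = 1 := by simp [sgn]

theorem sgn_ne_zero (u v : Finset (Fin n)) : sgn F u v ≠ 0 := by
  intro h
  have := sgn_sq (F := F) u v
  simp [h] at this

theorem sub_single_add_single {α : Fin m → ℕ} {i : Fin m} (h : α i ≠ 0) :
    α - Pi.single i 1 + Pi.single i 1 = α := by
  funext j
  by_cases hj : j = i
  · subst hj; simp; omega
  · simp [hj]

theorem mul_X_DBasis (r : Y m n) (a : Idx m n) :
    mul F (X r) (DBasis F r a) = Finsupp.single a (degIn r a : F) := by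
  obtain ⟨α, u⟩ := a
  rcases r with i | k
  · simp only [DBasis, X]
    split_ifs with h
    · simp [h]
    · rw [mul_single]
      simp only [mulBasis, Finset.disjoint_empty_left, if_true, sgn_empty_left,
        binom_single_one, Finset.empty_union, Finsupp.smul_single]
      rw [add_comm (Pi.single i 1), sub_single_add_single h]
      congr 1
      simp only [degIn_inl, Pi.sub_apply, Pi.single_eq_same]
      rw [← Nat.cast_add_one, Nat.sub_add_cancel (Nat.one_le_iff_ne_zero.2 h)]
      simp
  · simp only [DBasis, X]
    split_ifs with h
    · rw [mul_single]
      simp [mulBasis, binom_zero_left, h, Finset.insert_erase h, sgn_sq]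
    · simp [h]

theorem mul_X_D_apply (r : Y m n) (f : A F m n) (a : Idx m n) :
    mul F (X r) (D F r f) a = degIn r a * f a := by
  induction f using Finsupp.induction_linear with
  | zero => simp
  | add f g hf hg => simp [hf, hg, mul_add]
  | single b c =>
    rw [D_single, map_smul, mul_X_DBasis]
    by_cases h : b = a
    · subst h; simp [mul_comm]
    · simp [Finsupp.single_eq_of_ne' h]

theorem D_inl_apply (i : Fin m) (f : A F m n) (a : Idx m n) :
    D F (Sum.inl i) f a = f (a.1 + Pi.single i 1, a.2) := by
  induction f using Finsupp.induction_linear with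
  | zero => simp
  | add f g hf hg => simp [hf, hg]
  | single b c =>
    obtain ⟨α, u⟩ := a
    obtain ⟨β, v⟩ := b
    rw [D_single]
    simp only [DBasis]
    split_ifs with h
    · have : (β, v) ≠ (α + Pi.single i 1, u) := by
        intro e
        rw [show β = α + Pi.single i 1 from (Prod.ext_iff.1 e).1] at h
        simp at h
      simp [Finsupp.single_eq_of_ne' this]
    · have : (β - Pi.single i 1, v) = (α, u) ↔ (β, v) = (α + Pi.single i 1, u) := by
        simp only [Prod.mk.injEq]
        refine and_congr_left fun _ => ⟨fun e => ?_, fun e => ?_⟩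
        · rw [← e, sub_single_add_single h]
        · rw [e, add_tsub_cancel_right]
      simp only [Finsupp.smul_apply, Finsupp.single_apply, this]
      simp

theorem vectorField_single (r : Y m n) (f h : A F m n) :
    vectorField F (Pi.single r f) h = mul F f (D F r h) := by
  rw [vectorField_apply, Finset.sum_eq_single r]
  · rw [Pi.single_eq_same]
  · intro s _ hs; rw [Pi.single_eq_of_ne hs]; simp
  · simp

end Coordinates

section EvenPart

variable {F : Type*} [Field F] {m n p : ℕ} [Fact p.Prime] [CharP F p] {t : Fin m → ℕ}

/-- The labels `(a, r)` of the basis elements `x^(α) x^u D_r` of `𝒲`. -/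
def IsLabel (p : ℕ) (t : Fin m → ℕ) (r : Y m n) (a : Idx m n) : Prop :=
  (∀ i, a.1 i < p ^ t i) ∧ (a.2.card : ZMod 2) = tau r

theorem finite_isLabel (p : ℕ) (t : Fin m → ℕ) (r : Y m n) : {a | IsLabel p t r a}.Finite := by
  refine Set.Finite.subset (s := {α : Fin m → ℕ | ∀ i, α i < p ^ t i} ×ˢ Set.univ) ?_
    fun a ha => ⟨ha.1, trivial⟩
  exact (Set.Finite.pi' fun i => Set.finite_lt_nat (p ^ t i)).prod Set.finite_univ

/-- The coefficient of `x^(α) x^u D_r` in an element of `𝒲`, where `a = (α, u)`. -/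
noncomputable def coef (r : Y m n) (a : Idx m n) : evenW F n p t →ₗ[F] F :=
  Finsupp.lapply a ∘ₗ LinearMap.applyₗ (X r) ∘ₗ (evenW F n p t).toSubmodule.subtype

theorem coef_apply (r : Y m n) (a : Idx m n) (x : evenW F n p t) :
    coef r a x = (x : Module.End F (A F m n)) (X r) a := rfl

theorem eq_vectorField (x : evenW F n p t) :
    (x : Module.End F (A F m n)) = vectorField F fun r => (x : Module.End F (A F m n)) (X r) := by
  obtain ⟨f, -, hf⟩ := mem_W.1 x.2.1
  conv_lhs => rw [← hf]
  congr 1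
  funext r
  rw [← hf, vectorField_X]

theorem coef_ext {x y : evenW F n p t} (h : ∀ r a, coef r a x = coef r a y) : x = y := by
  apply Subtype.ext
  rw [eq_vectorField x, eq_vectorField y]
  congr 1
  funext r
  exact Finsupp.ext (h r)

theorem coef_eq_zero {r : Y m n} {a : Idx m n} (h : ¬ IsLabel p t r a) (x : evenW F n p t) :
    coef r a x = 0 := by
  by_contra hne
  refine h ⟨?_, ?_⟩
  · obtain ⟨f, hf, hfx⟩ := mem_W.1 x.2.1
    rw [coef_apply, ← hfx, vectorField_X] at hne
    exact (Finsupp.mem_supported _ _).1 (hf r) (Finsupp.mem_support_iff.2 hne)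
  · exact (Finsupp.mem_supported _ _).1 (x.2.2 _ _ (X_mem_parityPart r))
      (Finsupp.mem_support_iff.2 hne)

theorem vectorField_mem_evenW {f : Y m n → A F m n} (h1 : ∀ r, f r ∈ truncated F n p t)
    (h2 : ∀ r, f r ∈ parityPart F m n (tau r)) : vectorField F f ∈ evenW F n p t := by
  refine ⟨mem_W.2 ⟨f, h1, rfl⟩, fun θ x hx => ?_⟩
  rw [vectorField_apply]
  refine Submodule.sum_mem _ fun r _ => ?_
  have := mul_mem_parityPart (h2 r) (D_mem_parityPart r hx)
  rwa [← add_assoc, CharTwo.add_self_eq_zero, zero_add] at this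

open Classical in
/-- The element of `𝒲` with the coefficients of `f`, where those coefficients that do not belong to
a basis element of `𝒲` are dropped. -/
noncomputable def field : (Y m n → A F m n) →ₗ[F] evenW F n p t where
  toFun f := ⟨vectorField F fun r => (f r).filter (IsLabel p t r), vectorField_mem_evenW
    (fun r => (Finsupp.mem_supported _ _).2 fun a ha => by
      simp only [Finsupp.support_filter, Finset.coe_filter] at ha; exact ha.2.1)
    (fun r => (Finsupp.mem_supported _ _).2 fun a ha => by
      simp only [Finsupp.support_filter, Finset.coe_filter] at ha; exact ha.2.2)⟩
  map_add' f g := by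
    apply Subtype.ext
    simp only [Pi.add_apply, Finsupp.filter_add]
    exact map_add (vectorField F) _ _
  map_smul' c f := by
    apply Subtype.ext
    simp only [Pi.smul_apply, Finsupp.filter_smul]
    exact map_smul (vectorField F) c _

open Classical in
theorem coef_field (f : Y m n → A F m n) (r : Y m n) (a : Idx m n) :
    coef r a (field f : evenW F n p t) = if IsLabel p t r a then f r a else 0 := by
  rw [coef_apply]
  change vectorField F _ (X r) a = _
  rw [vectorField_X, Finsupp.filter_apply]

theorem coe_field {f : Y m n → A F m n} (h1 : ∀ r, f r ∈ truncated F n p t)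
    (h2 : ∀ r, f r ∈ parityPart F m n (tau r)) :
    ((field f : evenW F n p t) : Module.End F (A F m n)) = vectorField F f := by
  classical
  change vectorField F _ = _
  congr 1
  funext r
  refine Finsupp.filter_eq_self_iff _ _ |>.2 fun a ha => ⟨?_, ?_⟩
  · exact (Finsupp.mem_supported _ _).1 (h1 r) (Finsupp.mem_support_iff.2 ha)
  · exact (Finsupp.mem_supported _ _).1 (h2 r) (Finsupp.mem_support_iff.2 ha)

theorem field_coef (x : evenW F n p t) :
    field (fun r => (x : Module.End F (A F m n)) (X r)) = x := by
  refine coef_ext fun r a => ?_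
  rw [coef_field]
  split_ifs with h
  · rfl
  · rw [coef_eq_zero h]

open Classical in
/-- The element of `𝒲` with prescribed coefficients. -/
noncomputable def ofCoef (c : Y m n → Idx m n → F) : evenW F n p t :=
  field fun r => Finsupp.onFinset (finite_isLabel p t r).toFinset
    (fun a => if IsLabel p t r a then c r a else 0) fun a ha => by
      by_contra h
      exact ha (if_neg (by simpa using h))

open Classical in
theorem coef_ofCoef (c : Y m n → Idx m n → F) (r : Y m n) (a : Idx m n) :
    coef r a (ofCoef c : evenW F n p t) = if IsLabel p t r a then c r a else 0 := by
  rw [ofCoef, coef_field]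
  by_cases h : IsLabel p t r a <;> simp [h]

variable (F p t) in
/-- The basis element `x^(α) x^u D_r` of `𝒲`, where `a = (α, u)`; it is `0` if `(a, r)` is not the
label of a basis element. -/
noncomputable def e (r : Y m n) (a : Idx m n) : evenW F n p t :=
  field (Pi.single r (Finsupp.single a 1))

theorem field_single_single (r : Y m n) (a : Idx m n) (c : F) :
    (field (Pi.single r (Finsupp.single a c)) : evenW F n p t) = c • e F p t r a := by
  rw [e, ← map_smul, ← Pi.single_smul, Finsupp.smul_single, smul_eq_mul, mul_one]

open Classical in
theorem coef_e (r s : Y m n) (a b : Idx m n) :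
    coef r a (e F p t s b) = if IsLabel p t r a ∧ r = s ∧ a = b then 1 else 0 := by
  rw [e, coef_field]
  by_cases h : IsLabel p t r a
  · by_cases hr : r = s
    · subst hr
      simp [h, Finsupp.single_apply, eq_comm]
    · simp [hr]
  · simp [h]

theorem e_eq_zero {r : Y m n} {a : Idx m n} (h : ¬ IsLabel p t r a) : e F p t r a = 0 := by
  refine coef_ext fun s b => ?_
  rw [coef_e, map_zero, if_neg]
  rintro ⟨h1, rfl, rfl⟩
  exact h h1

theorem coe_e {r : Y m n} {a : Idx m n} (h : IsLabel p t r a) :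
    (e F p t r a : Module.End F (A F m n)) = vectorField F (Pi.single r (Finsupp.single a 1)) := by
  refine coe_field (fun s => ?_) fun s => ?_ <;>
  · by_cases hs : s = r
    · subst hs
      rw [Pi.single_eq_same]
      first
      | exact Finsupp.single_mem_supported F _ h.1
      | exact Finsupp.single_mem_supported F _ h.2
    · rw [Pi.single_eq_of_ne hs]
      exact zero_mem _

/-- The elements `x^(α) x^u D_r` span `𝒲`. -/
theorem linearMap_eq_zero {M : Type*} [AddCommGroup M] [Module F M] (φ : evenW F n p t →ₗ[F] M)
    (h : ∀ r a, IsLabel p t r a → φ (e F p t r a) = 0) : φ = 0 := by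
  have key : φ ∘ₗ field = 0 := by
    refine LinearMap.pi_ext' fun r => Finsupp.lhom_ext' fun a => LinearMap.ext_ring ?_
    change φ (e F p t r a) = 0
    by_cases hl : IsLabel p t r a
    · exact h r a hl
    · rw [e_eq_zero hl, map_zero]
  ext x
  rw [← field_coef x]
  exact LinearMap.congr_fun key _

theorem coe_lie_apply (x y : evenW F n p t) (f : A F m n) :
    ((⁅x, y⁆ : evenW F n p t) : Module.End F (A F m n)) f =
      (x : Module.End F (A F m n)) ((y : Module.End F (A F m n)) f) -
        (y : Module.End F (A F m n)) ((x : Module.End F (A F m n)) f) := rfl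

theorem apply_one (x : evenW F n p t) : (x : Module.End F (A F m n)) one = 0 := by
  rw [eq_vectorField, vectorField_apply]
  refine Finset.sum_eq_zero fun r _ => ?_
  cases r <;> simp [one, D_single, DBasis]

/-- Bracketing with `D_i` applies `D_i` to the coefficients. -/
theorem coef_lie_evenD (i : Fin m) (x : evenW F n p t) (r : Y m n) (a : Idx m n) :
    coef r a ⁅evenD F n p t i, x⁆ = coef r (a.1 + Pi.single i 1, a.2) x := by
  rw [coef_apply, coe_lie_apply]
  have : (x : Module.End F (A F m n)) ((evenD F n p t i : Module.End F (A F m n)) (X r)) = 0 := by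
    change (x : Module.End F (A F m n)) (D F (Sum.inl i) (X r)) = 0
    rw [D_X]
    split_ifs
    · exact apply_one x
    · exact map_zero _
  rw [this, sub_zero]
  exact D_inl_apply i _ a

variable (F p t) in
/-- The element `x_r D_r` of `𝒲`. -/
noncomputable def torus (r : Y m n) : evenW F n p t := e F p t r (xIdx r)

variable (F) in
/-- The weight of `x^(α) x^u D_s` under `x_r D_r`, where `a = (α, u)`. -/
def wt (r s : Y m n) (a : Idx m n) : F := degIn r a - if r = s then 1 else 0

theorem one_lt_pow (ht : ∀ i, 1 ≤ t i) (i : Fin m) : 1 < p ^ t i :=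
  Nat.one_lt_pow (by have := ht i; omega) (Fact.out : p.Prime).one_lt

theorem isLabel_xIdx (ht : ∀ i, 1 ≤ t i) (r : Y m n) : IsLabel p t r (xIdx r) := by
  rcases r with i | k
  · refine ⟨fun j => ?_, by simp [xIdx, tau]⟩
    by_cases h : j = i
    · subst h; simpa [xIdx] using one_lt_pow ht j
    · simpa [xIdx, h] using pow_pos (Fact.out : p.Prime).pos _
  · refine ⟨fun j => ?_, by simp [xIdx, tau]⟩
    simpa [xIdx] using pow_pos (Fact.out : p.Prime).pos _

theorem coef_lie_torus (ht : ∀ i, 1 ≤ t i) (r : Y m n) (x : evenW F n p t) (s : Y m n)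
    (a : Idx m n) : coef s a ⁅torus F p t r, x⁆ = wt F r s a * coef s a x := by
  rw [coef_apply, coe_lie_apply, torus, coe_e (isLabel_xIdx ht r), vectorField_single,
    vectorField_single, ← X_eq_single, Finsupp.sub_apply, mul_X_D_apply, D_X, wt]
  split_ifs with h
  · subst h
    rw [mul_one', sub_mul, one_mul]
    rfl
  · simp [coef_apply]

theorem lie_torus_e (ht : ∀ i, 1 ≤ t i) (r s : Y m n) (a : Idx m n) :
    ⁅torus F p t r, e F p t s a⁆ = wt F r s a • e F p t s a := by
  refine coef_ext fun q b => ?_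
  rw [coef_lie_torus ht, map_smul, coef_e, smul_eq_mul]
  split_ifs with h
  · rw [h.2.1, h.2.2]
  · simp

theorem evenD_eq_e (i : Fin m) : evenD F n p t i = e F p t (Sum.inl i) (0, ∅) := by
  apply Subtype.ext
  rw [coe_e]
  · refine LinearMap.ext fun f => ?_
    rw [vectorField_single]
    exact (one_mul' _).symm
  · exact ⟨fun j => pow_pos (Fact.out : p.Prime).pos _, by simp [tau]⟩

theorem lie_e {r s : Y m n} {a b : Idx m n} (ha : IsLabel p t r a) (hb : IsLabel p t s b) :
    ⁅e F p t r a, e F p t s b⁆ =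
      field (Pi.single s (mul F (Finsupp.single a 1) (DBasis F r b))) -
        field (Pi.single r (mul F (Finsupp.single b 1) (DBasis F s a))) := by
  have aux : ∀ {r s : Y m n} {a b : Idx m n}, IsLabel p t r a → IsLabel p t s b →
      ((field (Pi.single s (mul F (Finsupp.single a 1) (DBasis F r b))) : evenW F n p t) :
        Module.End F (A F m n)) =
      vectorField F (Pi.single s (mul F (Finsupp.single a 1) (DBasis F r b))) := by
    intro r s a b ha hb
    have hD : DBasis F r b = D F r (Finsupp.single b 1) := by rw [D_single, one_smul]
    refine coe_field (fun q => ?_) fun q => ?_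
    · by_cases hq : q = s
      · subst hq
        rw [Pi.single_eq_same, hD]
        exact mul_mem_truncated (Finsupp.single_mem_supported F _ ha.1)
          (D_mem_truncated r (Finsupp.single_mem_supported F _ hb.1))
      · rw [Pi.single_eq_of_ne hq]; exact zero_mem _
    · by_cases hq : q = s
      · subst hq
        rw [Pi.single_eq_same, hD]
        have := mul_mem_parityPart (F := F) (f := Finsupp.single a 1) (θ := tau r)
          (Finsupp.single_mem_supported F _ ha.2)
          (D_mem_parityPart (f := Finsupp.single b 1) (θ := tau q) r
            (Finsupp.single_mem_supported F _ hb.2))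
        rwa [← add_assoc, CharTwo.add_self_eq_zero, zero_add] at this
      · rw [Pi.single_eq_of_ne hq]; exact zero_mem _
  have par : ∀ {r : Y m n} {a : Idx m n}, IsLabel p t r a → ∀ q,
      (Pi.single r (Finsupp.single a 1) : Y m n → A F m n) q ∈ parityPart F m n (tau q) := by
    intro r a ha q
    by_cases hq : q = r
    · subst hq
      rw [Pi.single_eq_same]
      exact Finsupp.single_mem_supported F _ ha.2
    · rw [Pi.single_eq_of_ne hq]; exact zero_mem _
  apply Subtype.ext
  change (e F p t r a : Module.End F (A F m n)) * (e F p t s b : Module.End F (A F m n)) -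
    (e F p t s b : Module.End F (A F m n)) * (e F p t r a : Module.End F (A F m n)) =
    ((field (Pi.single s (mul F (Finsupp.single a 1) (DBasis F r b))) : evenW F n p t) :
        Module.End F (A F m n)) -
      ((field (Pi.single r (mul F (Finsupp.single b 1) (DBasis F s a))) : evenW F n p t) :
        Module.End F (A F m n))
  rw [aux ha hb, aux hb ha, coe_e ha, coe_e hb, vectorField_lie (par ha) (par hb)]
  refine Eq.trans ?_ (map_sub (vectorField F) _ _)
  have sm : ∀ (r s : Y m n) (a b : Idx m n) (q : Y m n),
      ∑ r', mul F ((Pi.single r (Finsupp.single a 1) : Y m n → A F m n) r')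
        (D F r' ((Pi.single s (Finsupp.single b 1) : Y m n → A F m n) q)) =
      (Pi.single s (mul F (Finsupp.single a 1) (DBasis F r b)) : Y m n → A F m n) q := by
    intro r s a b q
    rw [Finset.sum_eq_single r]
    · rw [Pi.single_eq_same]
      by_cases hq : q = s
      · subst hq
        rw [Pi.single_eq_same, Pi.single_eq_same, D_single, one_smul]
      · rw [Pi.single_eq_of_ne hq, Pi.single_eq_of_ne hq, map_zero, map_zero]
    · intro r' _ hr'
      rw [Pi.single_eq_of_ne hr', map_zero, LinearMap.zero_apply]
    · simp
  congr 1
  funext q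
  rw [Finset.sum_sub_distrib, sm, sm, Pi.sub_apply]

end EvenPart

/-! ### Brackets of basis elements -/

section Labels

variable {m n p : ℕ} {t : Fin m → ℕ}

theorem IsLabel.mono {r : Y m n} {α β : Fin m → ℕ} {u : Finset (Fin n)}
    (h : IsLabel p t r (α, u)) (hβ : β ≤ α) : IsLabel p t r (β, u) :=
  ⟨fun i => (hβ i).trans_lt (h.1 i), h.2⟩

theorem isLabel_inl_empty {α : Fin m → ℕ} (h : ∀ i, α i < p ^ t i) (j : Fin m) :
    IsLabel p t (Sum.inl j : Y m n) (α, ∅) := ⟨h, by simp [tau]⟩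

theorem two_ne_zero_of_lt {F : Type*} [Field F] [CharP F p] (hp : 3 < p) : (2 : F) ≠ 0 := by
  intro h
  have : ((2 : ℕ) : F) = 0 := by exact_mod_cast h
  rw [CharP.cast_eq_zero_iff F p] at this
  have := Nat.le_of_dvd (by norm_num) this
  omega

end Labels

section Brackets

variable {F : Type*} [Field F] {m n p : ℕ} [Fact p.Prime] [CharP F p] {t : Fin m → ℕ}

theorem zero_lt_pow (p : ℕ) [Fact p.Prime] (t : Fin m → ℕ) (i : Fin m) :
    (0 : Fin m → ℕ) i < p ^ t i := pow_pos (Fact.out : p.Prime).pos _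

theorem isLabel_pair {k l : Fin n} (h : k ≠ l) (j : Fin m) :
    IsLabel p t (Sum.inl j) (0, {k, l}) :=
  ⟨zero_lt_pow p t, by rw [Finset.card_pair h]; rfl⟩

theorem lie_evenD_e {i : Fin m} {s : Y m n} {α : Fin m → ℕ} {u : Finset (Fin n)}
    (h : IsLabel p t s (α, u)) :
    ⁅evenD F n p t i, e F p t s (α, u)⁆ =
      if α i = 0 then 0 else e F p t s (α - Pi.single i 1, u) := by
  refine coef_ext fun r b => ?_
  obtain ⟨β, v⟩ := b
  rw [coef_lie_evenD, coef_e]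
  split_ifs with h1 h2 h2
  · have := (Prod.ext_iff.1 h1.2.2).1
    simp only at this
    rw [← this] at h2
    simp at h2
  · have h3 := (Prod.ext_iff.1 h1.2.2).1
    have h4 := (Prod.ext_iff.1 h1.2.2).2
    simp only at h3 h4
    rw [coef_e, if_pos]
    exact ⟨h1.1.mono le_self_add, h1.2.1, by rw [← h3, ← h4, add_tsub_cancel_right]⟩
  · rw [map_zero]
  · rw [coef_e, if_neg]
    rintro ⟨-, rfl, h3⟩
    rw [Prod.mk.injEq] at h3
    refine h1 ⟨?_, rfl, ?_⟩
    · simp only [h3.1, h3.2, sub_single_add_single h2]; exact h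
    · simp only [h3.1, h3.2, sub_single_add_single h2]

theorem DBasis_inl (i : Fin m) (α : Fin m → ℕ) (u : Finset (Fin n)) :
    DBasis F (Sum.inl i) (α, u) =
      if α i = 0 then 0 else Finsupp.single (α - Pi.single i 1, u) 1 := rfl

/-- The bracket of two basis elements, where the second of the two terms vanishes. -/
theorem lie_e_inl {i : Fin m} {s : Y m n} {α β : Fin m → ℕ} {v w : Finset (Fin n)}
    (ha : IsLabel p t (Sum.inl i) (α, v)) (hb : IsLabel p t s (β, w))
    (hs : DBasis F s (α, v) = 0) (hi : β i ≠ 0) (hd : Disjoint v w) :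
    ⁅e F p t (Sum.inl i) (α, v), e F p t s (β, w)⁆ =
      (binom F α (β - Pi.single i 1) * sgn F v w) •
        e F p t s (α + (β - Pi.single i 1), v ∪ w) := by
  rw [lie_e ha hb, hs, map_zero, Pi.single_zero, map_zero, sub_zero, DBasis_inl, if_neg hi,
    mul_single, mulBasis, if_pos hd, one_mul, one_smul, field_single_single]

/-- The bracket in the Witt algebra `W(m)`. -/
theorem lie_e_witt {i j : Fin m} {β γ : Fin m → ℕ} (hβ : ∀ q, β q < p ^ t q)
    (hγ : ∀ q, γ q < p ^ t q) :
    ⁅e F p t (Sum.inl i : Y m n) (β, ∅), e F p t (Sum.inl j : Y m n) (γ, ∅)⁆ =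
      (if γ i = 0 then (0 : evenW F n p t) else
        binom F β (γ - Pi.single i 1) •
          e F p t (Sum.inl j : Y m n) (β + (γ - Pi.single i 1), ∅)) -
      (if β j = 0 then (0 : evenW F n p t) else
        binom F γ (β - Pi.single j 1) •
          e F p t (Sum.inl i : Y m n) (γ + (β - Pi.single j 1), ∅)) := by
  have aux : ∀ (j i : Fin m) (β γ : Fin m → ℕ),
      (field (Pi.single (Sum.inl j) (mul F (Finsupp.single (β, ∅) 1)
        (DBasis F (Sum.inl i) (γ, ∅)))) : evenW F n p t) =
      if γ i = 0 then 0 else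
        binom F β (γ - Pi.single i 1) • e F p t (Sum.inl j) (β + (γ - Pi.single i 1), ∅) := by
    intro j i β γ
    rw [DBasis_inl]
    by_cases h : γ i = 0
    · rw [if_pos h, if_pos h, map_zero, Pi.single_zero, map_zero]
    · rw [if_neg h, if_neg h]
      have h1 : mulBasis F ((β, ∅) : Idx m n) (γ - Pi.single i 1, ∅) =
          Finsupp.single (β + (γ - Pi.single i 1), ∅) (binom F β (γ - Pi.single i 1)) := by
        simp [mulBasis, sgn_empty_left]
      rw [mul_single, h1, one_mul, one_smul, field_single_single]
  rw [lie_e (isLabel_inl_empty hβ i) (isLabel_inl_empty hγ j), aux, aux]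

/-- `[x_k D_l, x_l x_q D_j] = x_k x_q D_j`, up to a sign, as `e` has the odd variables in increasing
order. -/
theorem lie_e_inr_pair {k l q : Fin n} (hlq : l ≠ q) (hkq : k ≠ q) (j : Fin m) :
    ∃ c : F, c ≠ 0 ∧ ⁅e F p t (Sum.inr l) (0, {k}), e F p t (Sum.inl j) (0, {l, q})⁆ =
      c • e F p t (Sum.inl j) (0, {k, q}) := by
  have h1 : IsLabel p t (Sum.inr l : Y m n) (0, {k}) := ⟨zero_lt_pow p t, by simp [tau]⟩
  have h2 : ({l, q} : Finset (Fin n)).erase l = {q} := by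
    rw [Finset.erase_insert]; simpa using hlq
  refine ⟨sgn F {l} {q} * sgn F {k} {q}, mul_ne_zero (sgn_ne_zero _ _) (sgn_ne_zero _ _), ?_⟩
  rw [lie_e h1 (isLabel_pair hlq j), DBasis_inl, if_pos (Pi.zero_apply j)]
  simp only [DBasis, Finset.mem_insert_self, if_true, h2]
  rw [mul_single, mulBasis, if_pos (by simpa using hkq)]
  simp only [map_zero, Pi.single_zero, sub_zero, binom_zero_left, one_mul, Finsupp.smul_single,
    smul_eq_mul, add_zero]
  rw [field_single_single]
  rfl

/-- The common centralizer of the `D_i` has constant coefficients. -/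
theorem eq_zero_of_coef_ne_zero {x : evenW F n p t} (h : ∀ i, ⁅evenD F n p t i, x⁆ = 0)
    {r : Y m n} {a : Idx m n} (ha : coef r a x ≠ 0) : a.1 = 0 := by
  funext i
  by_contra hi
  apply ha
  have := coef_lie_evenD i x r (a.1 - Pi.single i 1, a.2)
  rw [h i, map_zero] at this
  simp only [sub_single_add_single hi] at this
  exact this.symm

@[simp] theorem wt_inl (i : Fin m) (s : Y m n) (a : Idx m n) :
    wt F (Sum.inl i) s a = a.1 i - if Sum.inl i = s then 1 else 0 := rfl

@[simp] theorem wt_inr (k : Fin n) (s : Y m n) (a : Idx m n) :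
    wt F (Sum.inr k) s a = (if k ∈ a.2 then 1 else 0) - if Sum.inr k = s then 1 else 0 := by
  simp [wt]

/-- Among the basis elements with constant coefficients only the `x_k D_k` have weight zero. -/
theorem eq_of_wt_eq_zero {r : Y m n} {u : Finset (Fin n)} (h : ∀ q, wt F q r (0, u) = 0) :
    ∃ k, r = Sum.inr k ∧ u = {k} := by
  rcases r with i | k
  · have := h (Sum.inl i)
    simp at this
  · refine ⟨k, rfl, ?_⟩
    ext l
    have := h (Sum.inr l)
    rw [wt_inr] at this
    by_cases hl : l = k
    · subst hl
      by_cases h' : l ∈ u <;> simp [h'] at this ⊢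
    · have h'' : (Sum.inr l : Y m n) ≠ Sum.inr k := by simpa using hl
      by_cases h' : l ∈ u <;> simp [h', h'', hl] at this ⊢

theorem lie_sum_torus_pair (ht : ∀ i, 1 ≤ t i) (c : Fin n → F) {k l : Fin n} (hkl : k ≠ l)
    (j : Fin m) :
    ⁅∑ q, c q • torus F p t (Sum.inr q), e F p t (Sum.inl j) (0, {k, l})⁆ =
      (c k + c l) • e F p t (Sum.inl j) (0, {k, l}) := by
  rw [sum_lie]
  simp only [smul_lie, lie_torus_e ht, smul_smul, ← Finset.sum_smul]
  congr 1
  simp only [wt_inr, reduceCtorEq, if_false, sub_zero, mul_ite, mul_one, mul_zero]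
  rw [Finset.sum_ite_mem, Finset.univ_inter, Finset.sum_pair hkl]

/-- An element of the span of the `x_k D_k` acts on `x_k x_l D_j` by the sum of its coefficients
at `x_k D_k` and `x_l D_l`. -/
theorem lie_pair_of_torus (ht : ∀ i, 1 ≤ t i) {x : evenW F n p t}
    (hx : ∀ r a, coef r a x ≠ 0 → ∃ k, r = Sum.inr k ∧ a = (0, {k})) {k l : Fin n} (hkl : k ≠ l)
    (j : Fin m) :
    ⁅x, e F p t (Sum.inl j) (0, {k, l})⁆ = (coef (Sum.inr k) (0, {k}) x +
      coef (Sum.inr l) (0, {l}) x) • e F p t (Sum.inl j) (0, {k, l}) := by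
  have hsum : x = ∑ q : Fin n, coef (Sum.inr q) (0, {q}) x • torus F p t (Sum.inr q) := by
    refine coef_ext fun r a => ?_
    rw [map_sum]
    simp only [map_smul, torus, coef_e, xIdx]
    by_cases h : ∃ k, r = Sum.inr k ∧ a = (0, {k})
    · obtain ⟨k, rfl, rfl⟩ := h
      rw [Finset.sum_eq_single k]
      · rw [if_pos ⟨isLabel_xIdx ht (Sum.inr k), rfl, rfl⟩, smul_eq_mul, mul_one]
      · intro q _ hq
        rw [if_neg, smul_zero]
        rintro ⟨-, h, -⟩
        exact hq (Sum.inr_injective h).symm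
      · simp
    · rw [not_imp_comm.1 (hx r a) h, Finset.sum_eq_zero]
      intro q _
      rw [if_neg, smul_zero]
      exact fun h' => h ⟨q, h'.2.1, h'.2.2⟩
  conv_lhs => rw [hsum]
  exact lie_sum_torus_pair ht _ hkl j

/-- The `x_k x_l D_j` separate the elements of the span of the `x_k D_k`. -/
theorem eq_zero_of_torus (hp : 3 < p) (hn : 3 ≤ n) {x : evenW F n p t}
    (hx : ∀ r a, coef r a x ≠ 0 → ∃ k, r = Sum.inr k ∧ a = (0, {k}))
    (h : ∀ k l : Fin n, k ≠ l →
      coef (Sum.inr k) (0, {k}) x + coef (Sum.inr l) (0, {l}) x = 0) : x = 0 := by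
  refine coef_ext fun r a => ?_
  rw [map_zero]
  by_contra hra
  obtain ⟨k, rfl, rfl⟩ := hx r a hra
  obtain ⟨l, hl⟩ : ∃ l, l ∉ ({k} : Finset (Fin n)) := by
    by_contra! hc
    have := Finset.card_le_card (fun l _ => hc l : (Finset.univ : Finset (Fin n)) ⊆ _)
    simp at this
    omega
  obtain ⟨q, hq⟩ : ∃ q, q ∉ ({k, l} : Finset (Fin n)) := by
    by_contra! hc
    have := (Finset.card_le_card (fun l _ => hc l : (Finset.univ : Finset (Fin n)) ⊆ _)).trans
      Finset.card_le_two
    simp at this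
    omega
  simp only [Finset.mem_insert, Finset.mem_singleton, not_or] at hl hq
  refine hra (mul_left_cancel₀ (two_ne_zero_of_lt (F := F) hp) ?_)
  linear_combination h k l (Ne.symm hl) + h k q (Ne.symm hq.1) - h l q (Ne.symm hq.2)

theorem e_pair_ne_zero {k l : Fin n} (h : k ≠ l) (j : Fin m) :
    e F p t (Sum.inl j) (0, {k, l}) ≠ 0 := by
  intro h0
  have := coef_e (F := F) (p := p) (t := t) (Sum.inl j) (Sum.inl j) (0, {k, l}) (0, {k, l})
  rw [h0, map_zero, if_pos ⟨isLabel_pair h j, rfl, rfl⟩] at this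
  exact zero_ne_one this

theorem eq_zero_of_torus_of_lie (hp : 3 < p) (hn : 3 ≤ n) (ht : ∀ i, 1 ≤ t i) {x : evenW F n p t}
    (hx : ∀ r a, coef r a x ≠ 0 → ∃ k, r = Sum.inr k ∧ a = (0, {k})) (j : Fin m)
    (h : ∀ k l : Fin n, k ≠ l → ⁅x, e F p t (Sum.inl j) (0, {k, l})⁆ = 0) : x = 0 :=
  eq_zero_of_torus hp hn hx fun k l hkl => by
    have := h k l hkl
    rw [lie_pair_of_torus ht hx hkl] at this
    exact (smul_eq_zero.1 this).resolve_right (e_pair_ne_zero hkl j)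

/-- Only `0` commutes with all `D_i`, all `x_r D_r` and all `x_k x_l D_j`. -/
theorem eq_zero_of_lie (hp : 3 < p) (hn : 3 ≤ n) (ht : ∀ i, 1 ≤ t i) {x : evenW F n p t}
    (h1 : ∀ i, ⁅evenD F n p t i, x⁆ = 0) (h2 : ∀ r : Y m n, ⁅torus F p t r, x⁆ = 0) (j : Fin m)
    (h3 : ∀ k l : Fin n, k ≠ l → ⁅x, e F p t (Sum.inl j) (0, {k, l})⁆ = 0) : x = 0 := by
  refine eq_zero_of_torus_of_lie hp hn ht (fun r a ha => ?_) j h3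
  obtain ⟨α, u⟩ := a
  obtain rfl : α = 0 := eq_zero_of_coef_ne_zero h1 ha
  obtain ⟨k, rfl, rfl⟩ := eq_of_wt_eq_zero (F := F) (r := r) (u := u) fun q => by
    have := coef_lie_torus ht q x r (0, u)
    rw [h2, map_zero] at this
    exact (mul_eq_zero.1 this.symm).resolve_right ha
  exact ⟨k, rfl, rfl⟩

theorem lie_evenD_evenD (i j : Fin m) : ⁅evenD F n p t i, evenD F n p t j⁆ = 0 := by
  rw [evenD_eq_e j, lie_evenD_e (isLabel_inl_empty (zero_lt_pow p t) j), if_pos (Pi.zero_apply i)]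

theorem lie_evenD_pair (i j : Fin m) {k l : Fin n} (h : k ≠ l) :
    ⁅evenD F n p t i, e F p t (Sum.inl j) ((0, {k, l}) : Idx m n)⁆ = 0 := by
  rw [lie_evenD_e (isLabel_pair h j), if_pos (Pi.zero_apply i)]

theorem lie_evenD_torus (ht : ∀ i, 1 ≤ t i) (i : Fin m) (r : Y m n) :
    ⁅evenD F n p t i, torus F p t r⁆ = if r = Sum.inl i then evenD F n p t i else 0 := by
  rw [← lie_skew, evenD_eq_e, lie_torus_e ht, wt]
  by_cases h : r = Sum.inl i
  · subst h; simp
  · rw [if_neg h, if_neg h]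
    rcases r with i' | k <;> simp

end Brackets

/-! ### The values of a derivation at the `D_i` -/

section PowersOfDerivations

variable {F L : Type*} [Field F] {p : ℕ} [Fact p.Prime] [CharP F p] [LieRing L] [LieAlgebra F L]

theorem iterate_pow_char_lie (φ : LieDerivation F L L) (r : ℕ) (x y : L) :
    φ^[p ^ r] ⁅x, y⁆ = ⁅x, φ^[p ^ r] y⁆ - ⁅y, φ^[p ^ r] x⁆ := by
  have hpos : 0 < p ^ r := pow_pos (Fact.out : p.Prime).pos r
  rw [LieDerivation.iterate_apply_lie, Finset.sum_eq_add (0, p ^ r) (p ^ r, 0)]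
  · simp [sub_eq_add_neg]
  · intro h
    have := (Prod.ext_iff.1 h).1
    simp only at this
    omega
  · rintro ⟨a, b⟩ hab ⟨h1, h2⟩
    replace hab : a + b = p ^ r := Finset.HasAntidiagonal.mem_antidiagonal.1 hab
    have ha : a ≠ 0 := by rintro rfl; apply h1; rw [← hab]; simp
    have hb : a ≠ p ^ r := by
      rintro rfl
      apply h2
      rw [show b = 0 by omega]
    have hdvd : p ∣ (p ^ r).choose a := (Fact.out : p.Prime).dvd_choose_pow ha hb
    have h0 : (((p ^ r).choose a : ℕ) : F) = 0 := (CharP.cast_eq_zero_iff F p _).2 hdvd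
    simp only
    rw [← Nat.cast_smul_eq_nsmul F, h0, zero_smul]
  · simp
  · simp

/-- In characteristic `p` the power of a derivation to a power of `p` is a derivation. -/
def powChar (φ : LieDerivation F L L) (p : ℕ) [Fact p.Prime] [CharP F p] (r : ℕ) :
    LieDerivation F L L where
  toLinearMap := (φ : L →ₗ[F] L) ^ p ^ r
  leibniz' x y := by
    have : ∀ z, ((φ : L →ₗ[F] L) ^ p ^ r) z = φ^[p ^ r] z := fun z => by
      rw [Module.End.pow_apply]; rfl
    change ((φ : L →ₗ[F] L) ^ p ^ r) ⁅x, y⁆ =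
      ⁅x, ((φ : L →ₗ[F] L) ^ p ^ r) y⁆ - ⁅y, ((φ : L →ₗ[F] L) ^ p ^ r) x⁆
    rw [this, this, this, iterate_pow_char_lie]

theorem ad_apply_apply (x y : L) : LieDerivation.ad F L x y = ⁅x, y⁆ :=
  LinearMap.congr_fun (LieDerivation.coe_ad_apply_eq_ad_apply x) y

end PowersOfDerivations

section Constants

variable {F : Type*} [Field F] {m n p : ℕ} [Fact p.Prime] [CharP F p] {t : Fin m → ℕ}

variable (F n p t) in
/-- The derivation `(ad D_i)^(p^r)` of `𝒲`. -/
noncomputable def adPow (i : Fin m) (r : ℕ) : LieDerivation F (evenW F n p t) (evenW F n p t) :=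
  powChar (LieDerivation.ad F (evenW F n p t) (evenD F n p t i)) p r

theorem adPow_apply (i : Fin m) (r : ℕ) (x : evenW F n p t) :
    adPow F n p t i r x = (LieAlgebra.ad F (evenW F n p t) (evenD F n p t i) ^ p ^ r) x := by
  change ((LieDerivation.ad F (evenW F n p t) (evenD F n p t i) :
    evenW F n p t →ₗ[F] evenW F n p t) ^ p ^ r) x = _
  rw [LieDerivation.coe_ad_apply_eq_ad_apply]

theorem coef_ad_pow (i : Fin m) (k : ℕ) (x : evenW F n p t) (r : Y m n) (a : Idx m n) :
    coef r a ((LieAlgebra.ad F (evenW F n p t) (evenD F n p t i) ^ k) x) =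
      coef r (a.1 + Pi.single i k, a.2) x := by
  induction k generalizing x a with
  | zero => simp
  | succ k ih =>
    rw [pow_succ, Module.End.mul_apply, ih, LieAlgebra.ad_apply, coef_lie_evenD]
    simp only
    rw [add_assoc, ← Pi.single_add]

theorem ad_pow_eq_zero {i : Fin m} {x : evenW F n p t} (h : ⁅evenD F n p t i, x⁆ = 0) {k : ℕ}
    (hk : k ≠ 0) : (LieAlgebra.ad F (evenW F n p t) (evenD F n p t i) ^ k) x = 0 := by
  obtain ⟨k, rfl⟩ := Nat.exists_eq_succ_of_ne_zero hk
  rw [pow_succ, Module.End.mul_apply, LieAlgebra.ad_apply, h, map_zero]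

theorem ad_pow_lie {i : Fin m} {y : evenW F n p t} (h : ⁅evenD F n p t i, y⁆ = 0) (k : ℕ)
    (x : evenW F n p t) :
    (LieAlgebra.ad F (evenW F n p t) (evenD F n p t i) ^ k) ⁅x, y⁆ =
      ⁅(LieAlgebra.ad F (evenW F n p t) (evenD F n p t i) ^ k) x, y⁆ := by
  induction k generalizing x with
  | zero => simp
  | succ k ih =>
    rw [pow_succ, Module.End.mul_apply, Module.End.mul_apply, LieAlgebra.ad_apply,
      LieAlgebra.ad_apply, leibniz_lie, h, lie_zero, add_zero, ih]

theorem ad_pow_lie_torus (ht : ∀ i, 1 ≤ t i) (i : Fin m) (k : ℕ) (x : evenW F n p t) :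
    (LieAlgebra.ad F (evenW F n p t) (evenD F n p t i) ^ k) ⁅x, torus F p t (Sum.inl i : Y m n)⁆ =
      ⁅(LieAlgebra.ad F (evenW F n p t) (evenD F n p t i) ^ k) x, torus F p t (Sum.inl i)⁆ -
        (k : F) • (LieAlgebra.ad F (evenW F n p t) (evenD F n p t i) ^ k) x := by
  induction k with
  | zero => simp
  | succ k ih =>
    rw [pow_succ', Module.End.mul_apply, Module.End.mul_apply, ih, LieAlgebra.ad_apply,
      LieAlgebra.ad_apply, lie_sub, leibniz_lie, lie_evenD_torus ht, if_pos rfl, lie_smul,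
      ← lie_skew (evenD F n p t i) ((LieAlgebra.ad F (evenW F n p t) (evenD F n p t i) ^ k) x),
      Nat.cast_succ, add_smul, one_smul]
    simp only [smul_neg, neg_lie]
    abel

theorem ad_pow_top (ht : ∀ i, 1 ≤ t i) (i : Fin m) (x : evenW F n p t) :
    ⁅evenD F n p t i,
      (LieAlgebra.ad F (evenW F n p t) (evenD F n p t i) ^ (p ^ t i - 1)) x⁆ = 0 := by
  refine coef_ext fun r a => ?_
  rw [coef_lie_evenD, coef_ad_pow, map_zero]
  refine coef_eq_zero (fun h => ?_) x
  have := h.1 i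
  have := one_lt_pow (p := p) ht i
  simp at *
  omega

theorem map_lie_eq (φ : LieDerivation F (evenW F n p t) (evenW F n p t)) (x y : evenW F n p t) :
    φ ⁅x, y⁆ = ⁅φ x, y⁆ + ⁅x, φ y⁆ := by
  rw [LieDerivation.apply_lie_eq_sub, sub_eq_add_neg, lie_skew, add_comm]

/-- The value of a derivation at `D_i` has no terms of the highest degree `p^(t_i) - 1` in `x_i`.
The left side `c` is the coefficient of these terms; by the Leibniz rule it commutes with all `y` such
that `[D_i, y] = 0`, and also with `x_i D_i`. -/
theorem ad_pow_apply_evenD (hp : 3 < p) (hm : 3 ≤ m) (hn : 3 ≤ n) (ht : ∀ i, 1 ≤ t i)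
    (φ : LieDerivation F (evenW F n p t) (evenW F n p t)) (i : Fin m) :
    (LieAlgebra.ad F (evenW F n p t) (evenD F n p t i) ^ (p ^ t i - 1)) (φ (evenD F n p t i)) =
      0 := by
  set c := (LieAlgebra.ad F (evenW F n p t) (evenD F n p t i) ^ (p ^ t i - 1))
    (φ (evenD F n p t i)) with hc
  have hcomm : ∀ y : evenW F n p t, ⁅evenD F n p t i, y⁆ = 0 → ⁅c, y⁆ = 0 := by
    intro y hy
    have h1 := map_lie_eq φ (evenD F n p t i) y
    rw [hy, map_zero] at h1
    have h2 := congrArg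
      (LieAlgebra.ad F (evenW F n p t) (evenD F n p t i) ^ (p ^ t i - 1)) h1
    rw [map_zero, map_add, ad_pow_lie hy, ← LieAlgebra.ad_apply F _ (evenD F n p t i) (φ y),
      ← Module.End.mul_apply, ← pow_succ, pow_succ', Module.End.mul_apply, LieAlgebra.ad_apply,
      ad_pow_top ht, add_zero] at h2
    exact h2.symm
  have hcast : ((p ^ t i - 1 : ℕ) : F) = -1 := by
    rw [Nat.cast_sub (one_lt_pow ht i).le, Nat.cast_pow, CharP.cast_eq_zero F p,
      zero_pow (by have := ht i; omega), Nat.cast_one, zero_sub]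
  have hi : ⁅c, torus F p t (Sum.inl i : Y m n)⁆ = 0 := by
    have h1 := map_lie_eq φ (evenD F n p t i) (torus F p t (Sum.inl i))
    rw [lie_evenD_torus ht, if_pos rfl] at h1
    have h2 := congrArg
      (LieAlgebra.ad F (evenW F n p t) (evenD F n p t i) ^ (p ^ t i - 1)) h1
    rw [map_add, ad_pow_lie_torus ht,
      ← LieAlgebra.ad_apply F _ (evenD F n p t i) (φ (torus F p t (Sum.inl i))),
      ← Module.End.mul_apply (f := _ ^ _), ← pow_succ, pow_succ', Module.End.mul_apply,
      LieAlgebra.ad_apply, ad_pow_top ht, add_zero, hcast, neg_smul, one_smul, sub_neg_eq_add,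
      ← hc] at h2
    exact (right_eq_add.1 h2)
  refine eq_zero_of_lie hp hn ht (fun j => ?_) (fun r => ?_) ⟨0, by omega⟩
    fun k l hkl => hcomm _ (lie_evenD_pair i _ hkl)
  · rw [← lie_skew, hcomm _ (lie_evenD_evenD i j), neg_zero]
  · rw [← lie_skew, neg_eq_zero]
    by_cases hr : r = Sum.inl i
    · rw [hr, hi]
    · exact hcomm _ (by rw [lie_evenD_torus ht, if_neg hr])

/-- Integration with respect to `x_i`. -/
theorem exists_lie_evenD_eq {i : Fin m} {x : evenW F n p t}
    (h : (LieAlgebra.ad F (evenW F n p t) (evenD F n p t i) ^ (p ^ t i - 1)) x = 0) :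
    ∃ y, ⁅evenD F n p t i, y⁆ = x ∧
      ∀ j, j ≠ i → ⁅evenD F n p t j, x⁆ = 0 → ⁅evenD F n p t j, y⁆ = 0 := by
  classical
  refine ⟨ofCoef fun r a => if a.1 i = 0 then 0 else coef r (a.1 - Pi.single i 1, a.2) x,
    coef_ext fun r a => ?_, fun j hj hx => coef_ext fun r a => ?_⟩
  · have h0 : (a.1 + Pi.single i 1 : Fin m → ℕ) i ≠ 0 := by simp
    rw [coef_lie_evenD, coef_ofCoef]
    simp only [add_tsub_cancel_right]
    rw [if_neg h0]
    split_ifs with hl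
    · rfl
    · by_cases hl' : IsLabel p t r a
      · have ha : a.1 i = p ^ t i - 1 := by
          by_contra hne
          refine hl ⟨fun j => ?_, hl'.2⟩
          by_cases hj : j = i
          · subst hj
            have := hl'.1 j
            simp only [Pi.add_apply, Pi.single_eq_same]
            omega
          · simpa [hj] using hl'.1 j
        have := coef_ad_pow i (p ^ t i - 1) x r (a.1 - Pi.single i (p ^ t i - 1), a.2)
        rw [h, map_zero] at this
        refine this.trans (congrArg (fun b => coef r b x) (Prod.ext ?_ rfl))
        funext j
        by_cases hj : j = i
        · subst hj; simp [ha]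
        · simp [hj]
      · rw [coef_eq_zero hl']
  · rw [coef_lie_evenD, coef_ofCoef, map_zero]
    have hx' : coef r (a.1 + Pi.single j 1 - Pi.single i 1, a.2) x = 0 ∨ a.1 i = 0 := by
      by_cases ha : a.1 i = 0
      · exact Or.inr ha
      left
      have := coef_lie_evenD j x r (a.1 - Pi.single i 1, a.2)
      rw [hx, map_zero] at this
      rw [this]
      congr 2
      rw [sub_single_add _ _ _ ha]
    rcases hx' with h0 | h0
    · simp [h0]
    · simp [h0, hj.symm]

/-- A derivation agrees with an inner derivation at the `D_i`. -/
theorem exists_ad_eq_evenD (hp : 3 < p) (hm : 3 ≤ m) (hn : 3 ≤ n) (ht : ∀ i, 1 ≤ t i)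
    (φ : LieDerivation F (evenW F n p t) (evenW F n p t)) :
    ∃ x : evenW F n p t, ∀ i, φ (evenD F n p t i) = ⁅x, evenD F n p t i⁆ := by
  suffices h : ∀ S : Finset (Fin m), ∃ x : evenW F n p t,
      ∀ i ∈ S, φ (evenD F n p t i) = ⁅x, evenD F n p t i⁆ by
    obtain ⟨x, hx⟩ := h Finset.univ
    exact ⟨x, fun i => hx i (Finset.mem_univ i)⟩
  intro S
  induction S using Finset.induction_on with
  | empty => exact ⟨0, by simp⟩
  | insert i S hi ih =>
    obtain ⟨x, hx⟩ := ih
    set ψ := φ - LieDerivation.ad F (evenW F n p t) x with hψ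
    have hψ' : ∀ z, ψ z = φ z - ⁅x, z⁆ := fun z => by
      rw [hψ, LieDerivation.sub_apply, ad_apply_apply]
    obtain ⟨y, hy, hy'⟩ := exists_lie_evenD_eq (ad_pow_apply_evenD hp hm hn ht ψ i)
    refine ⟨x - y, fun j hj => ?_⟩
    rw [sub_lie, ← lie_skew y, sub_neg_eq_add]
    rcases Finset.mem_insert.1 hj with rfl | hj
    · rw [hy, hψ', add_sub_cancel]
    · rw [hy' j (fun h => hi (h ▸ hj)), add_zero, hx j hj]
      have h1 := map_lie_eq ψ (evenD F n p t j) (evenD F n p t i)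
      rw [lie_evenD_evenD, map_zero, hψ' (evenD F n p t j), hx j hj, sub_self, zero_lie,
        zero_add] at h1
      exact h1.symm

end Constants

/-! ### The torus spanned by the `x_r D_r` -/

section Torus

variable {F : Type*} [Field F] {m n p : ℕ} [Fact p.Prime] [CharP F p] {t : Fin m → ℕ}

theorem wt_xIdx (r s : Y m n) : wt F r s (xIdx s) = 0 := by
  rcases r with i | k <;> rcases s with j | l
  · by_cases h : i = j <;> simp [xIdx, h]
  · simp [xIdx]
  · simp [xIdx]
  · by_cases h : k = l <;> simp [xIdx, h]

theorem lie_torus_torus (ht : ∀ i, 1 ≤ t i) (r s : Y m n) :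
    ⁅torus F p t r, torus F p t s⁆ = 0 :=
  (lie_torus_e ht r s (xIdx s)).trans (by rw [wt_xIdx, zero_smul])

theorem apply_lie_evenD {φ : LieDerivation F (evenW F n p t) (evenW F n p t)}
    (hφ : ∀ i, φ (evenD F n p t i) = 0) (i : Fin m) (x : evenW F n p t) :
    ⁅evenD F n p t i, φ x⁆ = φ ⁅evenD F n p t i, x⁆ := by
  rw [map_lie_eq, hφ, zero_lie, zero_add]

/-- A derivation that vanishes at the `D_i` agrees with an inner derivation at the torus spanned by
the `x_r D_r`. -/
theorem exists_ad_eq_torus (hp : 3 < p) (hm : 3 ≤ m) (hn : 3 ≤ n) (ht : ∀ i, 1 ≤ t i)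
    {φ : LieDerivation F (evenW F n p t) (evenW F n p t)} (hφ : ∀ i, φ (evenD F n p t i) = 0) :
    ∃ x : evenW F n p t, (∀ i, ⁅x, evenD F n p t i⁆ = 0) ∧
      ∀ r : Y m n, φ (torus F p t r) = ⁅x, torus F p t r⁆ := by
  classical
  have hC : ∀ r i, ⁅evenD F n p t i, φ (torus F p t r)⁆ = 0 := by
    intro r i
    rw [apply_lie_evenD hφ, lie_evenD_torus ht]
    split_ifs
    · exact hφ i
    · exact map_zero φ
  have hrel : ∀ r r' s a, wt F r s a * coef s a (φ (torus F p t r')) =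
      wt F r' s a * coef s a (φ (torus F p t r)) := by
    intro r r' s a
    have h := congrArg (coef s a) (map_lie_eq φ (torus F p t r) (torus F p t r'))
    rw [lie_torus_torus ht, map_zero, map_zero, map_add, ← lie_skew, map_neg,
      coef_lie_torus ht, coef_lie_torus ht] at h
    linear_combination -h
  -- the coefficient of the weight vector is determined by any `r` for which the weight is nonzero
  let c : Y m n → Idx m n → F := fun s a => if a.1 = 0 then
    if h : ∃ r, wt F r s a ≠ 0 then
      - coef s a (φ (torus F p t h.choose)) / wt F h.choose s a else 0 else 0
  have hx : ∀ i, ⁅(ofCoef c : evenW F n p t), evenD F n p t i⁆ = 0 := by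
    intro i
    rw [← lie_skew, neg_eq_zero]
    refine coef_ext fun r a => ?_
    rw [coef_lie_evenD, coef_ofCoef, map_zero]
    split_ifs
    · refine if_neg fun h => ?_
      have := congrFun h i
      simp at this
    · rfl
  refine ⟨ofCoef c, hx, fun r => ?_⟩
  set ψ := φ - LieDerivation.ad F (evenW F n p t) (ofCoef c) with hψ
  have hψ' : ∀ z, ψ z = φ z - ⁅(ofCoef c : evenW F n p t), z⁆ := fun z => by
    rw [hψ, LieDerivation.sub_apply, ad_apply_apply]
  have hsupp : ∀ s a, coef s a (ψ (torus F p t r)) ≠ 0 → ∃ k, s = Sum.inr k ∧ a = (0, {k}) := by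
    intro s a hsa
    have hl : IsLabel p t s a := by
      by_contra h
      exact hsa (coef_eq_zero h _)
    obtain ⟨α, u⟩ := a
    have hD : ∀ i, ⁅evenD F n p t i, ψ (torus F p t r)⁆ = 0 := by
      intro i
      rw [hψ', lie_sub, hC, leibniz_lie, ← lie_skew (evenD F n p t i) (ofCoef c), hx,
        lie_evenD_torus ht]
      split_ifs
      · simp [hx]
      · simp
    obtain rfl : α = 0 := eq_zero_of_coef_ne_zero hD hsa
    rw [hψ', map_sub, ← lie_skew, map_neg, coef_lie_torus ht, sub_neg_eq_add, coef_ofCoef,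
      if_pos hl] at hsa
    have hw : ∀ q, wt F q s (0, u) = 0 := by
      by_contra! h
      apply hsa
      have h' : wt F h.choose s ((0, u) : Idx m n) ≠ 0 := h.choose_spec
      simp only [c, if_true, dif_pos h]
      field_simp
      linear_combination hrel h.choose r s (0, u)
    obtain ⟨k, rfl, rfl⟩ := eq_of_wt_eq_zero hw
    exact ⟨k, rfl, rfl⟩
  have h0 : ψ (torus F p t r) = 0 := by
    refine eq_zero_of_torus hp hn hsupp fun k l hkl => ?_
    let j : Fin m := ⟨0, by omega⟩
    have h := map_lie_eq ψ (torus F p t r) (e F p t (Sum.inl j) (0, {k, l}))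
    rw [lie_torus_e ht, map_smul, lie_pair_of_torus ht hsupp hkl] at h
    have h' := congrArg (coef (Sum.inl j) (0, {k, l})) h
    rw [map_add, map_smul, map_smul, coef_lie_torus ht, coef_e,
      if_pos ⟨isLabel_pair hkl j, rfl, rfl⟩] at h'
    simp only [smul_eq_mul, mul_one] at h'
    linear_combination -h'
  rw [hψ', sub_eq_zero] at h0
  exact h0

/-- A derivation that vanishes at the `D_i` and the `x_r D_r` preserves weights. -/
theorem wt_eq_of_coef_ne_zero (ht : ∀ i, 1 ≤ t i)
    {φ : LieDerivation F (evenW F n p t) (evenW F n p t)} (hφ : ∀ r : Y m n, φ (torus F p t r) = 0)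
    {r s : Y m n} {a b : Idx m n} (h : coef r b (φ (e F p t s a)) ≠ 0) (q : Y m n) :
    wt F q r b = wt F q s a := by
  have h1 := congrArg (coef r b) (map_lie_eq φ (torus F p t q) (e F p t s a))
  rw [lie_torus_e ht, map_smul, map_smul, hφ, zero_lie, zero_add, coef_lie_torus ht,
    smul_eq_mul] at h1
  exact (mul_right_cancel₀ h h1).symm

theorem eq_of_wt_eq_inl {r : Y m n} {j : Fin m} {u v : Finset (Fin n)}
    (h : ∀ q, wt F q r (0, v) = wt F q (Sum.inl j) (0, u)) : r = Sum.inl j ∧ v = u := by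
  have hr : r = Sum.inl j := by
    by_contra hr
    have := h (Sum.inl j)
    simp [Ne.symm hr] at this
  subst hr
  refine ⟨rfl, ?_⟩
  ext k
  have := h (Sum.inr k)
  rw [wt_inr, wt_inr, sub_left_inj] at this
  by_cases hv : k ∈ v <;> by_cases hu : k ∈ u <;> simp [hv, hu] at this ⊢

theorem eq_of_wt_eq_inr (h2 : (2 : F) ≠ 0) {r : Y m n} {l : Fin n} {u v : Finset (Fin n)}
    (hl : l ∉ u) (h : ∀ q, wt F q r (0, v) = wt F q (Sum.inr l) (0, u)) :
    r = Sum.inr l ∧ v = u := by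
  have hr : r = Sum.inr l := by
    by_contra hr
    have := h (Sum.inr l)
    by_cases hv : l ∈ v
    · simp [Ne.symm hr, hl, hv] at this
      exact h2 (by linear_combination this)
    · simp [Ne.symm hr, hl, hv] at this
  subst hr
  refine ⟨rfl, ?_⟩
  ext k
  have := h (Sum.inr k)
  rw [wt_inr, wt_inr, sub_left_inj] at this
  by_cases hv : k ∈ v <;> by_cases hu : k ∈ u <;> simp [hv, hu] at this ⊢

theorem eq_smul_e {x : evenW F n p t} {s : Y m n} {a : Idx m n}
    (h : ∀ r b, coef r b x ≠ 0 → r = s ∧ b = a) : x = coef s a x • e F p t s a := by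
  refine coef_ext fun r b => ?_
  rw [map_smul, coef_e]
  by_cases hx : coef r b x = 0
  · rw [hx]
    split_ifs with h'
    · rw [← h'.2.1, ← h'.2.2, hx, zero_smul]
    · rw [smul_zero]
  · obtain ⟨rfl, rfl⟩ := h r b hx
    have hl : IsLabel p t r b := by
      by_contra h'
      exact hx (coef_eq_zero h' x)
    rw [if_pos ⟨hl, rfl, rfl⟩, smul_eq_mul, mul_one]

/-- If a derivation `φ` vanishes at the `D_i` and the `x_r D_r`, and at `[D_i, y]` for all `i`,
where `y` is a basis element, then `φ y` has constant coefficients and the weight of `y`. -/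
theorem apply_e_constant (ht : ∀ i, 1 ≤ t i)
    {φ : LieDerivation F (evenW F n p t) (evenW F n p t)} (h1 : ∀ i, φ (evenD F n p t i) = 0)
    (h2 : ∀ r : Y m n, φ (torus F p t r) = 0) {s : Y m n} {α : Fin m → ℕ} {u : Finset (Fin n)}
    (hy : ∀ i, α i ≠ 0 → φ (e F p t s (α - Pi.single i 1, u)) = 0)
    {r : Y m n} {b : Idx m n} (h : coef r b (φ (e F p t s (α, u))) ≠ 0) :
    ∃ v, b = (0, v) ∧ ∀ q, wt F q r (0, v) = wt F q s (α, u) := by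
  have hl : IsLabel p t s (α, u) := by
    by_contra hl
    apply h
    rw [e_eq_zero hl, map_zero, map_zero]
  have hw := wt_eq_of_coef_ne_zero ht h2 h
  obtain ⟨β, v⟩ := b
  obtain rfl : β = 0 := by
    refine eq_zero_of_coef_ne_zero (fun i => ?_) h
    rw [apply_lie_evenD h1, lie_evenD_e hl]
    split_ifs with hi
    · exact map_zero φ
    · exact hy i hi
  exact ⟨v, rfl, hw⟩

theorem apply_e_inl_zero (ht : ∀ i, 1 ≤ t i)
    {φ : LieDerivation F (evenW F n p t) (evenW F n p t)} (h1 : ∀ i, φ (evenD F n p t i) = 0)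
    (h2 : ∀ r : Y m n, φ (torus F p t r) = 0) (j : Fin m) (u : Finset (Fin n)) :
    ∃ c : F, φ (e F p t (Sum.inl j) (0, u)) = c • e F p t (Sum.inl j) (0, u) := by
  refine ⟨_, eq_smul_e fun r b h => ?_⟩
  obtain ⟨v, rfl, hw⟩ := apply_e_constant ht h1 h2 (fun i hi => absurd rfl hi) h
  obtain ⟨rfl, rfl⟩ := eq_of_wt_eq_inl hw
  exact ⟨rfl, rfl⟩

theorem apply_e_inr_zero (hp : 3 < p) (ht : ∀ i, 1 ≤ t i)
    {φ : LieDerivation F (evenW F n p t) (evenW F n p t)} (h1 : ∀ i, φ (evenD F n p t i) = 0)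
    (h2 : ∀ r : Y m n, φ (torus F p t r) = 0) {l : Fin n} {u : Finset (Fin n)} (hl : l ∉ u) :
    ∃ c : F, φ (e F p t (Sum.inr l) (0, u)) = c • e F p t (Sum.inr l) (0, u) := by
  refine ⟨_, eq_smul_e fun r b h => ?_⟩
  obtain ⟨v, rfl, hw⟩ := apply_e_constant ht h1 h2 (fun i hi => absurd rfl hi) h
  obtain ⟨rfl, rfl⟩ := eq_of_wt_eq_inr (two_ne_zero_of_lt hp) hl hw
  exact ⟨rfl, rfl⟩

/-- A derivation that vanishes at the `D_i` and the `x_r D_r` can be altered by a combination of the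
`x_k D_k` so that it vanishes at the `x_k x_l D_j`, too. -/
theorem exists_ad_eq_pair (hp : 3 < p) (hn : 3 ≤ n) (ht : ∀ i, 1 ≤ t i)
    {φ : LieDerivation F (evenW F n p t) (evenW F n p t)} (h1 : ∀ i, φ (evenD F n p t i) = 0)
    (h2 : ∀ r : Y m n, φ (torus F p t r) = 0) (j : Fin m) :
    ∃ x : evenW F n p t, (∀ i, ⁅x, evenD F n p t i⁆ = 0) ∧ (∀ r : Y m n, ⁅x, torus F p t r⁆ = 0) ∧
      ∀ k l, k ≠ l →
        φ (e F p t (Sum.inl j) (0, {k, l})) = ⁅x, e F p t (Sum.inl j) (0, {k, l})⁆ := by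
  have two := two_ne_zero_of_lt (F := F) hp
  have hb := fun k l : Fin n => apply_e_inl_zero ht h1 h2 j {k, l}
  choose b hb using hb
  have ha := fun k l : Fin n => fun h : k ≠ l =>
    apply_e_inr_zero hp ht h1 h2 (l := l) (u := {k}) (by simpa using h.symm)
  choose! a ha using ha
  have hrel : ∀ k l q, k ≠ l → l ≠ q → k ≠ q → b k q = a k l + b l q := by
    intro k l q hkl hlq hkq
    obtain ⟨c, hc, hbr⟩ := lie_e_inr_pair (F := F) (p := p) (t := t) hlq hkq j
    have h := map_lie_eq φ (e F p t (Sum.inr l) (0, {k})) (e F p t (Sum.inl j) (0, {l, q}))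
    rw [ha k l hkl, hb l q, hbr, map_smul, hb k q, smul_lie, lie_smul, hbr, ← add_smul, smul_smul,
      smul_smul, ← sub_eq_zero, ← sub_smul] at h
    have h0 := (smul_eq_zero.1 h).resolve_right (e_pair_ne_zero hkq j)
    exact mul_left_cancel₀ hc (by linear_combination h0)
  have hsymm : ∀ k l, k ≠ l → b k l = b l k := by
    intro k l hkl
    have h := hb k l
    rw [Finset.pair_comm, hb l k, ← sub_eq_zero, ← sub_smul] at h
    exact (sub_eq_zero.1 ((smul_eq_zero.1 h).resolve_right (e_pair_ne_zero hkl.symm j))).symm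
  let o : Fin n := ⟨0, by omega⟩
  let i₁ : Fin n := ⟨1, by omega⟩
  have ho : i₁ ≠ o := by simp [o, i₁, Fin.ext_iff]
  -- normalised by `c k = a k o`, the numbers `b k l - c k - c l` do not depend on `k` and `l`
  let c : Fin n → F := fun k => if k = o then 0 else a k o
  have hco : c o = 0 := if_pos rfl
  have hc : ∀ k, k ≠ o → c k = a k o := fun k hk => if_neg hk
  have hstep : ∀ k q, k ≠ o → q ≠ o → k ≠ q → b k q = c k + b o q := fun k q hk hq hkq => by
    rw [hc k hk]; exact hrel k o q hk hq.symm hkq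
  have hconst : ∀ q, q ≠ o → b o q - c q = b o i₁ - c i₁ := by
    intro q hq
    by_cases hqi : q = i₁
    · rw [hqi]
    · linear_combination hstep q i₁ hq ho hqi - hstep i₁ q ho hq (Ne.symm hqi) -
        hsymm q i₁ hqi
  have hkey : ∀ k l, k ≠ l → b k l = c k + c l + (b o i₁ - c i₁) := by
    intro k l hkl
    by_cases hk : k = o
    · subst hk
      linear_combination hconst l hkl.symm - hco
    · by_cases hl : l = o
      · subst hl
        rw [hsymm k o hkl]
        linear_combination hconst k hkl - hco
      · linear_combination hstep k l hk hl hkl + hconst l hl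
  refine ⟨∑ q, (c q + (b o i₁ - c i₁) / 2) • torus F p t (Sum.inr q), fun i => ?_, fun r => ?_,
    fun k l hkl => ?_⟩
  · rw [sum_lie]
    refine Finset.sum_eq_zero fun q _ => ?_
    rw [smul_lie, ← lie_skew, lie_evenD_torus ht, if_neg (by simp), neg_zero, smul_zero]
  · rw [sum_lie]
    refine Finset.sum_eq_zero fun q _ => ?_
    rw [smul_lie, lie_torus_torus ht, smul_zero]
  · rw [lie_sum_torus_pair ht _ hkl, hb k l, hkey k l hkl]
    congr 1
    field_simp
    ring

/-- Every derivation agrees with an inner derivation at the `D_i`, the `x_r D_r`, and the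
`x_k x_l D_j` for a fixed `j`. -/
theorem exists_ad_eq (hp : 3 < p) (hm : 3 ≤ m) (hn : 3 ≤ n) (ht : ∀ i, 1 ≤ t i)
    (φ : LieDerivation F (evenW F n p t) (evenW F n p t)) (j : Fin m) :
    ∃ x : evenW F n p t, (∀ i, φ (evenD F n p t i) = ⁅x, evenD F n p t i⁆) ∧
      (∀ r : Y m n, φ (torus F p t r) = ⁅x, torus F p t r⁆) ∧
      ∀ k l, k ≠ l →
        φ (e F p t (Sum.inl j) (0, {k, l})) = ⁅x, e F p t (Sum.inl j) (0, {k, l})⁆ := by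
  obtain ⟨x, hx⟩ := exists_ad_eq_evenD hp hm hn ht φ
  set φ₁ := φ - LieDerivation.ad F (evenW F n p t) x with h₁
  have h₁' : ∀ z, φ₁ z = φ z - ⁅x, z⁆ := fun z => by
    rw [h₁, LieDerivation.sub_apply, ad_apply_apply]
  have hD : ∀ i, φ₁ (evenD F n p t i) = 0 := fun i => by rw [h₁', hx, sub_self]
  obtain ⟨y, hy1, hy2⟩ := exists_ad_eq_torus hp hm hn ht hD
  set φ₂ := φ₁ - LieDerivation.ad F (evenW F n p t) y with h₂
  have h₂' : ∀ z, φ₂ z = φ₁ z - ⁅y, z⁆ := fun z => by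
    rw [h₂, LieDerivation.sub_apply, ad_apply_apply]
  obtain ⟨z, hz1, hz2, hz3⟩ := exists_ad_eq_pair hp hn ht (φ := φ₂)
    (fun i => by rw [h₂', hD, hy1, sub_self]) (fun r => by rw [h₂', hy2, sub_self]) j
  refine ⟨x + y + z, fun i => ?_, fun r => ?_, fun k l hkl => ?_⟩
  · rw [add_lie, add_lie, hy1, hz1, add_zero, add_zero, hx]
  · rw [add_lie, add_lie, hz2, add_zero, ← hy2, h₁', add_sub_cancel]
  · rw [add_lie, add_lie, ← hz3 k l hkl, h₂', h₁']
    abel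

end Torus

/-! ### Normalized derivations vanish -/

section Decomposition

theorem not_dvd_choose_pow_mul {p : ℕ} [hp : Fact p.Prime] (r : ℕ) {s : ℕ} (hs : ¬ p ∣ s) :
    ¬ p ∣ (p ^ r * s).choose (p ^ r) := by
  induction r with
  | zero => simpa using hs
  | succ r ih =>
    have h := Choose.choose_modEq_choose_mod_mul_choose_div_nat (n := p ^ (r + 1) * s)
      (k := p ^ (r + 1)) (p := p)
    have hpos := hp.out.pos
    have h1 : p ^ (r + 1) * s = p * (p ^ r * s) := by rw [pow_succ]; ring
    have h2 : p ^ (r + 1) = p * p ^ r := by rw [pow_succ]; ring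
    rw [h1, h2, Nat.mul_mod_right, Nat.mul_mod_right, Nat.mul_div_cancel_left _ hpos,
      Nat.mul_div_cancel_left _ hpos, Nat.choose_self, one_mul] at h
    rw [h1, h2, (h.dvd_iff dvd_rfl)]
    exact ih

theorem exists_eq_single_or_eq_add {F : Type*} [Field F] {p m : ℕ} [hp : Fact p.Prime] [CharP F p]
    {α : Fin m → ℕ} (h0 : α ≠ 0) (hα : ∀ i, (α i : F) = 0) :
    (∃ i r, 1 ≤ r ∧ α = Pi.single i (p ^ r)) ∨ ∃ β γ : Fin m → ℕ, β ≠ 0 ∧ γ ≠ 0 ∧ β + γ = α ∧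
      (∀ i, (β i : F) = 0) ∧ (∀ i, (γ i : F) = 0) ∧ binom F β γ ≠ 0 := by
  obtain ⟨i, hi⟩ := Function.ne_iff.1 h0
  simp only [Pi.zero_apply] at hi
  by_cases h : ∃ j, j ≠ i ∧ α j ≠ 0
  · right
    obtain ⟨j, hji, hj⟩ := h
    refine ⟨Pi.single i (α i), Function.update α i 0, fun h => hi ?_, fun h => hj ?_,
      ?_, ?_, ?_, ?_⟩
    · simpa using congrFun h i
    · simpa [hji] using congrFun h j
    · funext q
      by_cases hq : q = i
      · subst hq; simp
      · simp [hq]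
    · intro q
      by_cases hq : q = i
      · subst hq; simp [hα]
      · simp [hq]
    · intro q
      by_cases hq : q = i
      · subst hq; simp
      · simp [hq, hα]
    · rw [binom, Finset.prod_eq_one]
      · exact one_ne_zero
      · intro q _
        by_cases hq : q = i
        · subst hq; simp
        · simp [hq]
  · push Not at h
    have hα' : α = Pi.single i (α i) := by
      funext q
      by_cases hq : q = i
      · subst hq; simp
      · simp [hq, h q hq]
    obtain ⟨r, s, hs, hrs⟩ := Nat.exists_eq_pow_mul_and_not_dvd hi p hp.out.ne_one
    have hr : 1 ≤ r := by
      by_contra hr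
      have := (CharP.cast_eq_zero_iff F p _).1 (hα i)
      rw [hrs, show r = 0 by omega, pow_zero, one_mul] at this
      exact hs this
    have hpr : ((p ^ r : ℕ) : F) = 0 := by
      rw [Nat.cast_pow, CharP.cast_eq_zero, zero_pow (by omega)]
    by_cases hs1 : s = 1
    · left
      refine ⟨i, r, hr, ?_⟩
      rw [hα', hrs, hs1, mul_one]
    · right
      have hpos : 0 < p ^ r := pow_pos hp.out.pos r
      have hs2 : 2 ≤ s := by
        have : s ≠ 0 := by rintro rfl; simp at hs
        omega
      have hlt : p ^ r < α i := by rw [hrs]; nlinarith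
      have hsub : ((α i - p ^ r : ℕ) : F) = 0 := by
        rw [Nat.cast_sub hlt.le, hα, hpr, sub_zero]
      refine ⟨Pi.single i (p ^ r), Pi.single i (α i - p ^ r), fun h => hpos.ne' ?_, fun h => ?_,
        ?_, ?_, ?_, ?_⟩
      · simpa using congrFun h i
      · have := congrFun h i
        simp at this
        omega
      · rw [← Pi.single_add, Nat.add_sub_cancel' hlt.le, ← hα']
      · intro q
        by_cases hq : q = i
        · subst hq; simpa using hpr
        · simp [hq]
      · intro q
        by_cases hq : q = i
        · subst hq; simpa using hsub
        · simp [hq]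
      · rw [binom, Finset.prod_eq_single i]
        · simp only [Pi.single_eq_same]
          rw [Nat.add_sub_cancel' hlt.le, hrs, ne_eq, CharP.cast_eq_zero_iff F p]
          exact not_dvd_choose_pow_mul r hs
        · intro q _ hq; simp [hq]
        · simp

end Decomposition

section Vanishing

theorem succ_ne_pow {F : Type*} [Field F] {m p : ℕ} [CharP F p] {t : Fin m → ℕ}
    (ht : ∀ i, 1 ≤ t i) {a : ℕ} (i : Fin m) (h : (a : F) + 1 ≠ 0) :
    a + 1 ≠ p ^ t i := fun h1 => h <| by
  have := ht i
  rw [← Nat.cast_add_one, h1, Nat.cast_pow, CharP.cast_eq_zero F p, zero_pow (by omega)]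

theorem sum_sub_single {m : ℕ} {α : Fin m → ℕ} {i : Fin m} (h : α i ≠ 0) :
    ∑ q, (α - Pi.single i 1 : Fin m → ℕ) q + 1 = ∑ q, α q := by
  conv_rhs => rw [← sub_single_add_single h]
  simp [Finset.sum_add_distrib]

theorem sum_add_single {m : ℕ} (α : Fin m → ℕ) (i : Fin m) :
    ∑ q, (α + Pi.single i 1 : Fin m → ℕ) q = ∑ q, α q + 1 := by
  simp [Finset.sum_add_distrib]

theorem cast_sub_single {F : Type*} [Field F] {m : ℕ} {α : Fin m → ℕ} {i : Fin m} (h : α i ≠ 0)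
    (q : Fin m) :
    (((α - Pi.single i 1 : Fin m → ℕ) q : ℕ) : F) = α q - if q = i then 1 else 0 := by
  by_cases hq : q = i
  · subst hq
    rw [Pi.sub_apply, Pi.single_eq_same, Nat.cast_sub (Nat.one_le_iff_ne_zero.2 h)]
    simp
  · simp [hq]

theorem one_ne_neg_one {F : Type*} [Field F] {p : ℕ} [CharP F p] (hp : 3 < p) : (1 : F) ≠ -1 :=
  fun h =>
    two_ne_zero_of_lt (F := F) hp (by linear_combination h)

variable {F : Type*} [Field F] {m n p : ℕ} [Fact p.Prime] [CharP F p] {t : Fin m → ℕ}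

/-- A derivation of `𝒲` that vanishes at the `D_i`, the `x_r D_r` and the `x_k x_l D_j` for some
`j`, and has no component along the `(ad D_i)^(p^r)`. -/
structure IsNormalized (φ : LieDerivation F (evenW F n p t) (evenW F n p t)) : Prop where
  evenD (i : Fin m) : φ (evenD F n p t i) = 0
  torus (r : Y m n) : φ (torus F p t r) = 0
  pair : ∃ j : Fin m, ∀ k l : Fin n, k ≠ l → φ (e F p t (Sum.inl j) (0, {k, l})) = 0
  pow (i : Fin m) (r : ℕ) : 1 ≤ r →
    coef (Sum.inl i) (0, ∅) (φ (e F p t (Sum.inl i) (Pi.single i (p ^ r), ∅))) = 0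

variable {φ : LieDerivation F (evenW F n p t) (evenW F n p t)}

theorem apply_eq_zero_of_lie {x y z : evenW F n p t} {c : F} (hx : φ x = 0) (hy : φ y = 0)
    (h : ⁅x, y⁆ = c • z) (hc : c ≠ 0) : φ z = 0 := by
  have := map_lie_eq φ x y
  rw [hx, hy, zero_lie, lie_zero, add_zero, h, map_smul] at this
  exact (smul_eq_zero.1 this).resolve_left hc

theorem e_ne_zero {s : Y m n} {a : Idx m n} (h : IsLabel p t s a) : e F p t s a ≠ 0 := by
  intro h0
  have := coef_e (F := F) (p := p) (t := t) s s a a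
  rw [h0, map_zero, if_pos ⟨h, rfl, rfl⟩] at this
  exact zero_ne_one this

theorem apply_e_eq_zero_of_not {s : Y m n} {a : Idx m n} (h : ¬ IsLabel p t s a) :
    φ (e F p t s a) = 0 := by rw [e_eq_zero h, map_zero]

namespace IsNormalized

theorem constant (hφ : IsNormalized φ) (ht : ∀ i, 1 ≤ t i) {s : Y m n} {α : Fin m → ℕ}
    {u : Finset (Fin n)} (hy : ∀ i, α i ≠ 0 → φ (e F p t s (α - Pi.single i 1, u)) = 0)
    {r : Y m n} {b : Idx m n} (h : coef r b (φ (e F p t s (α, u))) ≠ 0) :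
    ∃ v, b = (0, v) ∧ ∀ q, wt F q r (0, v) = wt F q s (α, u) :=
  apply_e_constant ht hφ.evenD hφ.torus hy h

/-- The weights of the elements with constant coefficients under `x_i D_i` are `0` and `-1`. -/
theorem apply_eq_zero_of_wt (hφ : IsNormalized φ) (ht : ∀ i, 1 ≤ t i) {s : Y m n} {α : Fin m → ℕ}
    {u : Finset (Fin n)} (hy : ∀ i, α i ≠ 0 → φ (e F p t s (α - Pi.single i 1, u)) = 0)
    (i : Fin m) (h0 : wt F (Sum.inl i) s (α, u) ≠ 0) (h1 : wt F (Sum.inl i) s (α, u) ≠ -1) :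
    φ (e F p t s (α, u)) = 0 := by
  refine coef_ext fun r b => ?_
  rw [map_zero]
  by_contra h
  obtain ⟨v, rfl, hw⟩ := hφ.constant ht hy h
  have := hw (Sum.inl i)
  rw [← this, wt_inl] at h0 h1
  by_cases hr : Sum.inl i = r <;> simp [hr] at h0 h1

theorem exists_notMem_pair (hn : 3 ≤ n) (k l : Fin n) : ∃ q, q ≠ k ∧ q ≠ l := by
  by_contra! hc
  have h : (Finset.univ : Finset (Fin n)) ⊆ {k, l} := fun q _ => by
    by_cases hq : q = k
    · simp [hq]
    · simp [hc q hq]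
  have := (Finset.card_le_card h).trans Finset.card_le_two
  simp at this
  omega

theorem single_sub_single {i j : Fin m} (h : (Pi.single i 1 : Fin m → ℕ) j ≠ 0) :
    (Pi.single i 1 : Fin m → ℕ) - Pi.single j 1 = 0 := by
  by_cases hj : j = i
  · rw [hj, tsub_self]
  · simp [hj] at h

theorem apply_inr (hφ : IsNormalized φ) (hp : 3 < p) (hn : 3 ≤ n) (ht : ∀ i, 1 ≤ t i)
    (k l : Fin n) : φ (e F p t (Sum.inr l) (0, {k})) = 0 := by
  by_cases hkl : k = l
  · subst hkl; exact hφ.torus (Sum.inr k)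
  obtain ⟨q, hqk, hql⟩ := exists_notMem_pair hn k l
  obtain ⟨j, hj⟩ := hφ.pair
  obtain ⟨c, hc⟩ := apply_e_inr_zero hp ht hφ.evenD hφ.torus (l := l) (u := {k})
    (by simpa using Ne.symm hkl)
  obtain ⟨d, hd, hbr⟩ := lie_e_inr_pair (F := F) (p := p) (t := t) hql.symm hqk.symm j
  have h := map_lie_eq φ (e F p t (Sum.inr l) (0, {k})) (e F p t (Sum.inl j) (0, {l, q}))
  rw [hbr, map_smul, hj k q hqk.symm, hj l q hql.symm, lie_zero, add_zero, smul_zero, hc, smul_lie,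
    hbr, smul_smul] at h
  have := (mul_eq_zero.1 ((smul_eq_zero.1 h.symm).resolve_right
    (e_pair_ne_zero hqk.symm j))).resolve_right hd
  rw [hc, this, zero_smul]

theorem apply_inl_single (hφ : IsNormalized φ) (hp : 3 < p) (ht : ∀ i, 1 ≤ t i) (i l : Fin m) :
    φ (e F p t (Sum.inl l) (Pi.single i 1, ∅)) = 0 := by
  by_cases hil : i = l
  · subst hil; exact hφ.torus (Sum.inl i)
  · refine hφ.apply_eq_zero_of_wt ht (fun j hj => ?_) i ?_ ?_
    · rw [single_sub_single hj, ← evenD_eq_e]; exact hφ.evenD l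
    · simp [hil]
    · simpa [hil] using one_ne_neg_one hp

theorem apply_inr_single (hφ : IsNormalized φ) (hp : 3 < p) (hn : 3 ≤ n) (ht : ∀ i, 1 ≤ t i)
    (i : Fin m) (k l : Fin n) : φ (e F p t (Sum.inr l) (Pi.single i 1, {k})) = 0 := by
  refine hφ.apply_eq_zero_of_wt ht (fun j hj => ?_) i ?_ ?_
  · rw [single_sub_single hj]; exact hφ.apply_inr hp hn ht k l
  · simp
  · simpa using one_ne_neg_one hp

theorem single_lt_pow (ht : ∀ i, 1 ≤ t i) (i j : Fin m) :
    (Pi.single i 1 : Fin m → ℕ) j < p ^ t j := by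
  by_cases h : j = i
  · subst h; simpa using one_lt_pow ht j
  · simpa [h] using zero_lt_pow p t j

theorem DBasis_inl_zero (i : Fin m) (u : Finset (Fin n)) : DBasis F (Sum.inl i) (0, u) = 0 := by
  rw [DBasis_inl, if_pos (Pi.zero_apply i)]

theorem apply_pair (hφ : IsNormalized φ) (hp : 3 < p) (ht : ∀ i, 1 ≤ t i) (j : Fin m)
    {k l : Fin n} (hkl : k ≠ l) : φ (e F p t (Sum.inl j) (0, {k, l})) = 0 := by
  obtain ⟨i, hi⟩ := hφ.pair
  have h := lie_e_inl (F := F) (isLabel_pair hkl i)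
    (isLabel_inl_empty (single_lt_pow ht i) j) (DBasis_inl_zero j _) (by simp)
    (Finset.disjoint_empty_right _)
  rw [tsub_self, add_zero, Finset.union_empty, binom_zero_left, sgn_empty_right] at h
  exact apply_eq_zero_of_lie (hi k l hkl) (hφ.apply_inl_single hp ht i j) h (by simp)

theorem apply_inl_single_pair (hφ : IsNormalized φ) (hp : 3 < p) (ht : ∀ i, 1 ≤ t i)
    {i j : Fin m} (hij : j ≠ i) {k l : Fin n} (hkl : k ≠ l) :
    φ (e F p t (Sum.inl i) (Pi.single j 1, {k, l})) = 0 := by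
  refine hφ.apply_eq_zero_of_wt ht (fun q hq => ?_) j ?_ ?_
  · rw [single_sub_single hq]; exact hφ.apply_pair hp ht i hkl
  · simp [hij]
  · simpa [hij] using one_ne_neg_one hp

theorem apply_inl_zero (hφ : IsNormalized φ) (hp : 3 < p) (hm : 3 ≤ m) (ht : ∀ i, 1 ≤ t i)
    (u : Finset (Fin n)) (i : Fin m) : φ (e F p t (Sum.inl i) (0, u)) = 0 := by
  have : Nontrivial (Fin m) := Fin.nontrivial_iff_two_le.2 (by omega)
  induction h : u.card using Nat.strong_induction_on generalizing u i with
  | _ d ih =>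
  by_cases hl : IsLabel p t (Sum.inl i) ((0, u) : Idx m n)
  swap
  · exact apply_e_eq_zero_of_not hl
  rcases Finset.eq_empty_or_nonempty u with rfl | hne
  · rw [← evenD_eq_e]; exact hφ.evenD i
  have hcard : 1 < u.card := by
    have h1 := hne.card_pos
    have h2 : u.card ≠ 1 := fun h2 => by
      have := hl.2
      simp only [h2, tau] at this
      exact absurd this (by decide)
    omega
  obtain ⟨k, hk, l, hlu, hkl⟩ := Finset.one_lt_card.1 hcard
  have hsub : ({k, l} : Finset (Fin n)) ⊆ u := by
    intro q hq
    rcases Finset.mem_insert.1 hq with rfl | hq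
    · exact hk
    · rw [Finset.mem_singleton.1 hq]; exact hlu
  have hc := Finset.card_sdiff_add_card_eq_card hsub
  rw [Finset.card_pair hkl] at hc
  obtain ⟨j, hj⟩ := exists_ne i
  have hv : IsLabel p t (Sum.inl j) ((0, u \ {k, l}) : Idx m n) := by
    refine ⟨zero_lt_pow p t, ?_⟩
    have := hl.2
    simp only [← hc] at this
    push_cast at this
    rw [show (2 : ZMod 2) = 0 from rfl, add_zero] at this
    exact this
  have hb : IsLabel p t (Sum.inl i) ((Pi.single j 1, {k, l}) : Idx m n) :=
    ⟨single_lt_pow ht j, (isLabel_pair (p := p) (t := t) hkl i).2⟩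
  have h := lie_e_inl (F := F) hv hb (DBasis_inl_zero i _) (by simp) Finset.sdiff_disjoint
  rw [tsub_self, add_zero, binom_zero_left, one_mul, Finset.sdiff_union_of_subset hsub] at h
  exact apply_eq_zero_of_lie (ih _ (by omega) _ j rfl)
    (hφ.apply_inl_single_pair hp ht hj hkl) h (sgn_ne_zero _ _)

/-- The case of `x^(α) D_j` where the value of `φ` is a multiple of `D_i`, `i ≠ j`: the bracket of
`x^(α) D_j` with `x_i D_j` vanishes, while that of `D_i` with `x_i D_j` does not. -/
theorem apply_witt_of_neg_one (hφ : IsNormalized φ) (hp : 3 < p) (ht : ∀ i, 1 ≤ t i) {i j : Fin m}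
    (hij : i ≠ j) {α : Fin m → ℕ} (hα : (α i : F) = -1)
    (hy : ∀ q, α q ≠ 0 → φ (e F p t (Sum.inl j) (α - Pi.single q 1, ∅)) = 0) :
    φ (e F p t (Sum.inl j) (α, ∅)) = 0 := by
  by_cases hl : IsLabel p t (Sum.inl j) ((α, ∅) : Idx m n)
  swap
  · exact apply_e_eq_zero_of_not hl
  have hsm : φ (e F p t (Sum.inl j) (α, ∅)) =
      coef (Sum.inl i) (0, ∅) (φ (e F p t (Sum.inl j) (α, ∅))) • e F p t (Sum.inl i) (0, ∅) := by
    refine eq_smul_e fun r b h => ?_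
    obtain ⟨v, rfl, hw⟩ := hφ.constant ht hy h
    have hr : r = Sum.inl i := by
      by_contra hr
      have := hw (Sum.inl i)
      simp [hα, Ne.symm hr, hij] at this
    subst hr
    refine ⟨rfl, ?_⟩
    congr 1
    ext k
    have := hw (Sum.inr k)
    simpa using this
  set c := coef (Sum.inl i) (0, ∅) (φ (e F p t (Sum.inl j) (α, ∅))) with hc
  have hbr : ⁅e F p t (Sum.inl j : Y m n) (α, ∅), e F p t (Sum.inl j : Y m n) (Pi.single i 1, ∅)⁆ =
      0 := by
    rw [lie_e_witt hl.1 (single_lt_pow ht i), if_pos (by simp [hij.symm]), zero_sub, neg_eq_zero]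
    split_ifs with hj
    · rfl
    · rw [binom_single_one, cast_sub_single hj, hα, if_neg hij, sub_zero, neg_add_cancel, zero_smul]
  have h := map_lie_eq φ (e F p t (Sum.inl j : Y m n) (α, ∅))
    (e F p t (Sum.inl j : Y m n) (Pi.single i 1, ∅))
  rw [hbr, map_zero, hφ.apply_inl_single hp ht, lie_zero, add_zero, hsm, smul_lie, ← evenD_eq_e,
    lie_evenD_e (isLabel_inl_empty (single_lt_pow ht i) j), if_neg (by simp), tsub_self] at h
  rw [hsm, (smul_eq_zero.1 h.symm).resolve_right
    (e_ne_zero (isLabel_inl_empty (zero_lt_pow p t) j)), zero_smul]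

/-- The case of `x^(α) D_j` where the value of `φ` is a combination of the `x_k D_k`. -/
theorem apply_witt_of_one (hφ : IsNormalized φ) (hp : 3 < p) (hm : 3 ≤ m) (hn : 3 ≤ n)
    (ht : ∀ i, 1 ≤ t i) {j : Fin m} {α : Fin m → ℕ} (hα : ∀ i, (α i : F) = if i = j then 1 else 0)
    (hy : ∀ β : Fin m → ℕ, ∑ q, β q < ∑ q, α q → ∀ i, φ (e F p t (Sum.inl i) (β, ∅)) = 0) :
    φ (e F p t (Sum.inl j) (α, ∅)) = 0 := by
  have : Nontrivial (Fin m) := Fin.nontrivial_iff_two_le.2 (by omega)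
  by_cases hl : IsLabel p t (Sum.inl j) ((α, ∅) : Idx m n)
  swap
  · exact apply_e_eq_zero_of_not hl
  have hj : α j ≠ 0 := by
    intro h
    have := hα j
    simp [h] at this
  have hsupp : ∀ r a, coef r a (φ (e F p t (Sum.inl j) (α, ∅))) ≠ 0 →
      ∃ k, r = Sum.inr k ∧ a = (0, {k}) := by
    intro r a h
    obtain ⟨v, rfl, hw⟩ := hφ.constant ht
      (fun i hi => hy _ (by have := sum_sub_single hi; omega) j) h
    obtain ⟨k, rfl, rfl⟩ := eq_of_wt_eq_zero (F := F) (r := r) (u := v) fun q => by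
      rw [hw q]
      rcases q with i | k
      · simp [hα, eq_comm]
      · simp
    exact ⟨k, rfl, rfl⟩
  refine eq_zero_of_torus_of_lie hp hn ht hsupp j fun k l hkl => ?_
  have hpair := hφ.apply_pair hp ht j hkl
  have h := map_lie_eq φ (e F p t (Sum.inl j) (α, ∅)) (e F p t (Sum.inl j) (0, {k, l}))
  rw [hpair, lie_zero, add_zero] at h
  rw [← h, ← lie_skew, map_neg, neg_eq_zero, lie_e_inl (isLabel_pair hkl j) hl (DBasis_inl_zero j _)
    hj (Finset.disjoint_empty_right _), map_smul, zero_add, Finset.union_empty]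
  obtain ⟨i, hij⟩ := exists_ne j
  -- `x_k x_l x^(α - ε_j) D_j` is the bracket of `x_k x_l D_i` and `x^(α - ε_j + ε_i) D_j`
  have hlab : IsLabel p t (Sum.inl j) ((α - Pi.single j 1 + Pi.single i 1, ∅) : Idx m n) := by
    refine isLabel_inl_empty (fun q => ?_) j
    have hq := hl.1 q
    by_cases hqi : q = i
    · subst hqi
      have := succ_ne_pow (F := F) (p := p) ht q (a := α q) (by simp [hα, hij])
      simp [hij]
      simp at hq
      omega
    · simp [hqi]
      simp at hq
      omega
  have hz := lie_e_inl (F := F) (isLabel_pair hkl i) hlab (DBasis_inl_zero j _) (by simp)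
    (Finset.disjoint_empty_right _)
  rw [add_tsub_cancel_right, zero_add, Finset.union_empty, binom_zero_left, sgn_empty_right] at hz
  have hk : φ (e F p t (Sum.inl j) (α - Pi.single j 1 + Pi.single i 1, ∅)) = 0 := by
    refine hφ.apply_eq_zero_of_wt ht (fun q hq => hy _ ?_ j) i ?_ ?_
    · have h1 := sum_sub_single hq
      rw [sum_add_single, sum_sub_single hj] at h1
      omega
    · simp [hij, hα]
    · simpa [hij, hij.symm, hα] using one_ne_neg_one hp
  rw [apply_eq_zero_of_lie (hφ.apply_pair hp ht i hkl) hk hz (by simp), smul_zero]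

/-- The case of `x^(α) D_j` where the value of `φ` is a multiple of `D_j`: `x^(α) D_j` is a bracket
of elements of lower degree, up to an element of the case `apply_witt_of_neg_one`, unless `x^(α)` is
a power `x_i^(p^r)`. -/
theorem apply_witt_of_zero (hφ : IsNormalized φ) (hp : 3 < p) (hm : 3 ≤ m)
    (ht : ∀ i, 1 ≤ t i) {j : Fin m} {α : Fin m → ℕ} (hα : ∀ i, (α i : F) = 0)
    (hy : ∀ β : Fin m → ℕ, ∑ q, β q < ∑ q, α q → ∀ i, φ (e F p t (Sum.inl i) (β, ∅)) = 0) :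
    φ (e F p t (Sum.inl j) (α, ∅)) = 0 := by
  have : Nontrivial (Fin m) := Fin.nontrivial_iff_two_le.2 (by omega)
  by_cases hl : IsLabel p t (Sum.inl j) ((α, ∅) : Idx m n)
  swap
  · exact apply_e_eq_zero_of_not hl
  by_cases h0 : α = 0
  · rw [h0, ← evenD_eq_e]; exact hφ.evenD j
  rcases exists_eq_single_or_eq_add h0 hα with ⟨i, r, hr, hαr⟩ | ⟨β, γ, hβ, hγ, rfl, hβ0, hγ0, hb⟩
  · have hsm : ∀ s, φ (e F p t (Sum.inl s) (α, ∅)) =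
        coef (Sum.inl s) (0, ∅) (φ (e F p t (Sum.inl s) (α, ∅))) • e F p t (Sum.inl s) (0, ∅) := by
      intro s
      refine eq_smul_e fun r b h => ?_
      obtain ⟨v, rfl, hw⟩ := hφ.constant ht
        (fun i hi => hy _ (by have := sum_sub_single hi; omega) s) h
      obtain ⟨rfl, rfl⟩ := eq_of_wt_eq_inl (F := F) (r := r) (v := v) (j := s) (u := ∅) fun q => by
        rw [hw q]
        rcases q with i | k <;> simp [hα]
      exact ⟨rfl, rfl⟩
    have hi : φ (e F p t (Sum.inl i) (α, ∅)) = 0 := by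
      rw [hsm i, hαr, hφ.pow i r hr, zero_smul]
    by_cases hij : i = j
    · rw [← hij, hi]
    have hαi : α i ≠ 0 := by
      rw [hαr, Pi.single_eq_same]
      exact (pow_pos (Fact.out : p.Prime).pos r).ne'
    have hbr := lie_e_witt (F := F) (n := n) (i := j) (j := i) hl.1 (single_lt_pow (p := p) ht j)
    rw [if_neg (by simp), if_neg hαi, tsub_self, binom_zero_right, one_smul, add_zero,
      binom_single_one, cast_sub_single hαi, hα, if_neg (Ne.symm hij), sub_zero, zero_add,
      one_smul] at hbr
    have hk : φ (e F p t (Sum.inl j) (Pi.single j 1 + (α - Pi.single i 1), ∅)) = 0 := by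
      refine hφ.apply_witt_of_neg_one hp ht hij ?_ fun q hq => hy _ ?_ j
      · rw [Pi.add_apply, Nat.cast_add, cast_sub_single hαi, hα]
        simp [hij]
      · have h1 := sum_sub_single hq
        rw [add_comm (Pi.single j 1)] at h1 ⊢
        rw [sum_add_single, sum_sub_single hαi] at h1
        omega
    have h := map_lie_eq φ (e F p t (Sum.inl j : Y m n) (α, ∅))
      (e F p t (Sum.inl i : Y m n) (Pi.single j 1, ∅))
    rw [hbr, map_sub, hi, hk, sub_zero, hφ.apply_inl_single hp ht, lie_zero, add_zero, hsm j,
      smul_lie, ← evenD_eq_e, lie_evenD_e (isLabel_inl_empty (single_lt_pow ht j) i),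
      if_neg (by simp), tsub_self] at h
    rw [hsm j, (smul_eq_zero.1 h.symm).resolve_right
      (e_ne_zero (isLabel_inl_empty (zero_lt_pow p t) i)), zero_smul]
  · obtain ⟨i, hij⟩ := exists_ne j
    have hsum : ∑ q, (β + γ) q = ∑ q, β q + ∑ q, γ q := by
      simp [Finset.sum_add_distrib]
    have big : ∀ δ : Fin m → ℕ, δ ≠ 0 → (∀ q, (δ q : F) = 0) → 3 < ∑ q, δ q := by
      intro δ hδ hδ0
      obtain ⟨q, hq⟩ := Function.ne_iff.1 hδ
      have h1 := Nat.le_of_dvd (Nat.pos_of_ne_zero hq) ((CharP.cast_eq_zero_iff F p _).1 (hδ0 q))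
      have h2 := Finset.single_le_sum (f := δ) (fun _ _ => Nat.zero_le _) (Finset.mem_univ q)
      omega
    have h1 := big β hβ hβ0
    have h2 := big γ hγ hγ0
    have hlβ : ∀ q, β q < p ^ t q := fun q => (Nat.le_add_right _ _).trans_lt (hl.1 q)
    have hlγ : ∀ q, (γ + Pi.single i 1 : Fin m → ℕ) q < p ^ t q := by
      intro q
      have hq : γ q < p ^ t q := (Nat.le_add_left _ _).trans_lt (hl.1 q)
      by_cases hqi : q = i
      · subst hqi
        have := succ_ne_pow (F := F) (p := p) ht q (a := γ q) (by simp [hγ0])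
        simp
        omega
      · simpa [hqi] using hq
    have hbr := lie_e_witt (F := F) (n := n) (i := i) (j := j) hlβ hlγ
    rw [if_neg (by simp), add_tsub_cancel_right] at hbr
    have h := map_lie_eq φ (e F p t (Sum.inl i : Y m n) (β, ∅))
      (e F p t (Sum.inl j : Y m n) (γ + Pi.single i 1, ∅))
    rw [hy β (by omega), hy (γ + Pi.single i 1) (by rw [sum_add_single]; omega), zero_lie, lie_zero,
      add_zero, hbr, map_sub, map_smul] at h
    have hk : φ (if β j = 0 then (0 : evenW F n p t) else
        binom F (γ + Pi.single i 1) (β - Pi.single j 1) •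
          e F p t (Sum.inl i : Y m n) (γ + Pi.single i 1 + (β - Pi.single j 1), ∅)) = 0 := by
      split_ifs with hβj
      · exact map_zero φ
      · rw [map_smul, hφ.apply_witt_of_neg_one hp ht hij.symm, smul_zero]
        · rw [Pi.add_apply, Nat.cast_add, cast_sub_single hβj, hβ0]
          simp [hij.symm, hγ0]
        · refine fun q hq => hy _ ?_ i
          have h3 := sum_sub_single hq
          have h4 : ∑ q, (γ + Pi.single i 1 + (β - Pi.single j 1) : Fin m → ℕ) q =
              ∑ q, (β + γ) q := by
            have := sum_sub_single hβj
            rw [hsum, ← this, add_right_comm γ, sum_add_single]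
            simp only [Pi.add_apply γ, Finset.sum_add_distrib]
            omega
          omega
    rw [hk, sub_zero] at h
    exact (smul_eq_zero.1 h).resolve_left hb

theorem apply_witt (hφ : IsNormalized φ) (hp : 3 < p) (hm : 3 ≤ m) (hn : 3 ≤ n)
    (ht : ∀ i, 1 ≤ t i) (α : Fin m → ℕ) (j : Fin m) :
    φ (e F p t (Sum.inl j) (α, ∅)) = 0 := by
  induction h : ∑ q, α q using Nat.strong_induction_on generalizing α j with
  | _ d ih =>
  subst h
  have hy : ∀ β : Fin m → ℕ, ∑ q, β q < ∑ q, α q → ∀ i, φ (e F p t (Sum.inl i) (β, ∅)) = 0 :=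
    fun β hβ i => ih _ hβ β i rfl
  have hy' : ∀ q, α q ≠ 0 → φ (e F p t (Sum.inl j) (α - Pi.single q 1, ∅)) = 0 :=
    fun q hq => hy _ (by have := sum_sub_single hq; omega) j
  by_contra hne
  obtain ⟨r, b, hrb⟩ : ∃ r b, coef r b (φ (e F p t (Sum.inl j) (α, ∅))) ≠ 0 := by
    by_contra! hc
    exact hne (coef_ext fun r b => by rw [hc, map_zero])
  obtain ⟨v, rfl, hw⟩ := hφ.constant ht hy' hrb
  rcases r with i | k
  · by_cases hij : i = j
    · subst hij
      refine hne (hφ.apply_witt_of_zero hp hm ht (fun q => ?_) hy)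
      have := hw (Sum.inl q)
      rw [wt_inl, wt_inl] at this
      simp only [Pi.zero_apply, Nat.cast_zero] at this
      linear_combination -this
    · refine hne (hφ.apply_witt_of_neg_one hp ht hij ?_ hy')
      have := hw (Sum.inl i)
      simp [hij] at this
      exact this.symm
  · refine hne (hφ.apply_witt_of_one hp hm hn ht (fun q => ?_) hy)
    have := hw (Sum.inl q)
    rw [wt_inl, wt_inl] at this
    simp at this
    linear_combination -this

theorem apply_inl_of_lt (hφ : IsNormalized φ) (hp : 3 < p) (hm : 3 ≤ m) (hn : 3 ≤ n)
    (ht : ∀ i, 1 ≤ t i) {i : Fin m} (j : Fin m) {α : Fin m → ℕ} (hi : α i + 1 < p ^ t i)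
    (u : Finset (Fin n)) : φ (e F p t (Sum.inl j) (α, u)) = 0 := by
  by_cases hl : IsLabel p t (Sum.inl j) ((α, u) : Idx m n)
  swap
  · exact apply_e_eq_zero_of_not hl
  have hu : IsLabel p t (Sum.inl i) ((0, u) : Idx m n) := ⟨zero_lt_pow p t, hl.2⟩
  have hα : IsLabel p t (Sum.inl j) ((α + Pi.single i 1, ∅) : Idx m n) := by
    refine isLabel_inl_empty (fun q => ?_) j
    by_cases hq : q = i
    · subst hq; simpa using hi
    · simpa [hq] using hl.1 q
  have h := lie_e_inl (F := F) hu hα (DBasis_inl_zero j u) (by simp)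
    (Finset.disjoint_empty_right _)
  rw [add_tsub_cancel_right, zero_add, Finset.union_empty, binom_zero_left, sgn_empty_right] at h
  exact apply_eq_zero_of_lie (hφ.apply_inl_zero hp hm ht u i) (hφ.apply_witt hp hm hn ht _ j) h
    (by simp)

theorem apply_inl (hφ : IsNormalized φ) (hp : 3 < p) (hm : 3 ≤ m) (hn : 3 ≤ n)
    (ht : ∀ i, 1 ≤ t i) (j : Fin m) (α : Fin m → ℕ) (u : Finset (Fin n)) :
    φ (e F p t (Sum.inl j) (α, u)) = 0 := by
  by_cases hl : IsLabel p t (Sum.inl j) ((α, u) : Idx m n)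
  swap
  · exact apply_e_eq_zero_of_not hl
  by_cases hlt : α j + 1 < p ^ t j
  · exact hφ.apply_inl_of_lt hp hm hn ht j hlt u
  -- in the highest degree in `x_j` the weight under `x_j D_j` is `-2`
  have hw : wt F (Sum.inl j) (Sum.inl j) ((α, u) : Idx m n) = -2 := by
    have h1 : α j + 1 = p ^ t j := by have := hl.1 j; simp at this; omega
    have h2 : (α j : F) + 1 = 0 := by
      by_contra h
      exact succ_ne_pow ht j h h1
    simp
    linear_combination h2
  refine hφ.apply_eq_zero_of_wt ht (fun i hi => hφ.apply_inl_of_lt hp hm hn ht (i := i) j ?_ u)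
    j ?_ ?_
  · have := hl.1 i
    simp at this ⊢
    omega
  · rw [hw]
    simpa using two_ne_zero_of_lt (F := F) hp
  · rw [hw]
    intro h
    exact one_ne_zero (α := F) (by linear_combination -h)

theorem apply_inr_of_isLabel (hφ : IsNormalized φ) (hp : 3 < p) (hm : 3 ≤ m) (hn : 3 ≤ n)
    (ht : ∀ i, 1 ≤ t i) {k : Fin n} {α : Fin m → ℕ} {u : Finset (Fin n)}
    (hl : IsLabel p t (Sum.inr k) ((α, u) : Idx m n)) : φ (e F p t (Sum.inr k) (α, u)) = 0 := by
  obtain ⟨l, hlu, hkl⟩ : ∃ l ∈ u, k ∉ u.erase l := by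
    by_cases hk : k ∈ u
    · exact ⟨k, hk, by simp⟩
    · have hne : u.Nonempty := by
        rw [Finset.nonempty_iff_ne_empty]
        rintro rfl
        have := hl.2
        simp [tau] at this
      obtain ⟨l, hlu⟩ := hne
      exact ⟨l, hlu, fun h => hk (Finset.mem_of_mem_erase h)⟩
  let i : Fin m := ⟨0, by omega⟩
  have hv : IsLabel p t (Sum.inl i) ((α, u.erase l) : Idx m n) := by
    refine ⟨hl.1, ?_⟩
    have := hl.2
    simp only [← Finset.card_erase_add_one hlu, tau] at this
    push_cast at this
    simpa [tau] using this
  have hb : IsLabel p t (Sum.inr k) ((Pi.single i 1, {l}) : Idx m n) :=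
    ⟨single_lt_pow ht i, by simp [tau]⟩
  have h := lie_e_inl (F := F) hv hb (by simp only [DBasis, if_neg hkl]) (by simp) (by simp)
  rw [tsub_self, add_zero, binom_zero_right, one_mul, Finset.union_comm, ← Finset.insert_eq,
    Finset.insert_erase hlu] at h
  exact apply_eq_zero_of_lie (hφ.apply_inl hp hm hn ht i α _)
    (hφ.apply_inr_single hp hn ht i l k) h (sgn_ne_zero _ _)

theorem eq_zero (hφ : IsNormalized φ) (hp : 3 < p) (hm : 3 ≤ m) (hn : 3 ≤ n)
    (ht : ∀ i, 1 ≤ t i) (x : evenW F n p t) : φ x = 0 := by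
  have h := linearMap_eq_zero (φ : evenW F n p t →ₗ[F] evenW F n p t) fun r a ha => ?_
  · exact LinearMap.congr_fun h x
  · obtain ⟨α, u⟩ := a
    rcases r with j | k
    · exact hφ.apply_inl hp hm hn ht j α u
    · exact hφ.apply_inr_of_isLabel hp hm hn ht ha

end IsNormalized

end Vanishing

/-! ### The derivation algebra -/

section DerivationAlgebra

variable {F : Type*} [Field F] {m n p : ℕ} [Fact p.Prime] [CharP F p] {t : Fin m → ℕ}

theorem pow_ne_zero_of_prime (p : ℕ) [Fact p.Prime] (r : ℕ) : p ^ r ≠ 0 :=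
  (pow_pos (Fact.out : p.Prime).pos r).ne'

theorem adPow_evenD (i : Fin m) (r : ℕ) (j : Fin m) :
    adPow F n p t i r (evenD F n p t j) = 0 := by
  rw [adPow_apply, ad_pow_eq_zero (lie_evenD_evenD i j) (pow_ne_zero_of_prime p r)]

theorem adPow_pair (i : Fin m) (r : ℕ) (j : Fin m) {k l : Fin n} (h : k ≠ l) :
    adPow F n p t i r (e F p t (Sum.inl j) (0, {k, l})) = 0 := by
  rw [adPow_apply, ad_pow_eq_zero (lie_evenD_pair i j h) (pow_ne_zero_of_prime p r)]

theorem adPow_torus (ht : ∀ i, 1 ≤ t i) (i : Fin m) {r : ℕ} (hr : 1 ≤ r) (s : Y m n) :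
    adPow F n p t i r (torus F p t s) = 0 := by
  have hlt := Nat.one_lt_pow (Nat.one_le_iff_ne_zero.1 hr) (Fact.out : p.Prime).one_lt
  rw [adPow_apply, ← Nat.sub_add_cancel hlt.le, pow_succ, Module.End.mul_apply,
    LieAlgebra.ad_apply, lie_evenD_torus ht]
  split_ifs
  · exact ad_pow_eq_zero (lie_evenD_evenD i i) (by omega)
  · exact map_zero _

/-- The coefficients of `D_j` in the values at the `x_j^(p^s) D_j` tell the `(ad D_i)^(p^r)`
apart. -/
theorem coef_adPow_single {i j : Fin m} {r s : ℕ} (hs : s < t j) :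
    coef (Sum.inl j) (0, ∅) (adPow F n p t i r (e F p t (Sum.inl j) (Pi.single j (p ^ s), ∅))) =
      if i = j ∧ r = s then 1 else 0 := by
  classical
  rw [adPow_apply, coef_ad_pow, coef_e]
  simp only [zero_add]
  refine if_congr ⟨fun h => ?_, ?_⟩ rfl rfl
  · have h1 := (Prod.ext_iff.1 h.2.2).1
    simp only at h1
    have hij : i = j := by
      by_contra hij
      have := congrFun h1 i
      simp [hij] at this
      exact absurd this.1 (Fact.out : p.Prime).ne_zero
    subst hij
    have := congrFun h1 i
    simp only [Pi.single_eq_same] at this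
    exact ⟨rfl, Nat.pow_right_injective (Fact.out : p.Prime).two_le this⟩
  · rintro ⟨rfl, rfl⟩
    refine ⟨isLabel_inl_empty (fun q => ?_) i, trivial, rfl⟩
    by_cases hq : q = i
    · subst hq
      rw [Pi.single_eq_same]
      exact Nat.pow_lt_pow_right (Fact.out : p.Prime).one_lt hs
    · rw [Pi.single_eq_of_ne hq]
      exact zero_lt_pow p t q

/-- Every derivation is the sum of an inner derivation and a combination of the `(ad D_i)^(p^r)`. -/
theorem exists_eq_add (hp : 3 < p) (hm : 3 ≤ m) (hn : 3 ≤ n) (ht : ∀ i, 1 ≤ t i)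
    (φ : LieDerivation F (evenW F n p t) (evenW F n p t)) :
    ∃ (x : evenW F n p t) (b : Fin m → ℕ → F),
      φ = LieDerivation.ad F (evenW F n p t) x +
        ∑ i, ∑ r ∈ Finset.Ico 1 (t i), b i r • adPow F n p t i r := by
  let j : Fin m := ⟨0, by omega⟩
  obtain ⟨x, h1, h2, h3⟩ := exists_ad_eq hp hm hn ht φ j
  set ψ := φ - LieDerivation.ad F (evenW F n p t) x with hψ
  have hψ' : ∀ z, ψ z = φ z - ⁅x, z⁆ := fun z => by
    rw [hψ, LieDerivation.sub_apply, ad_apply_apply]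
  let b : Fin m → ℕ → F := fun i r =>
    coef (Sum.inl i) (0, ∅) (ψ (e F p t (Sum.inl i) (Pi.single i (p ^ r), ∅)))
  refine ⟨x, b, ?_⟩
  set χ := ∑ i, ∑ r ∈ Finset.Ico 1 (t i), b i r • adPow F n p t i r with hχ
  have hχ' : ∀ z, χ z = ∑ i, ∑ r ∈ Finset.Ico 1 (t i), b i r • adPow F n p t i r z := by
    intro z
    let ev : LieDerivation F (evenW F n p t) (evenW F n p t) →+ evenW F n p t :=
      { toFun := fun D => D z, map_zero' := rfl, map_add' := fun _ _ => rfl }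
    change ev χ = _
    rw [hχ, map_sum]
    refine Finset.sum_congr rfl fun i _ => ?_
    rw [map_sum]
    rfl
  have hN : IsNormalized (ψ - χ) := by
    refine ⟨fun i => ?_, fun r => ?_, ⟨j, fun k l hkl => ?_⟩, fun i r hr => ?_⟩
    · rw [LieDerivation.sub_apply, hψ', h1, hχ']
      simp [adPow_evenD]
    · rw [LieDerivation.sub_apply, hψ', h2, hχ', sub_self, zero_sub, neg_eq_zero]
      refine Finset.sum_eq_zero fun i _ => Finset.sum_eq_zero fun s hs => ?_
      rw [adPow_torus ht i (Finset.mem_Ico.1 hs).1, smul_zero]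
    · rw [LieDerivation.sub_apply, hψ', h3 k l hkl, hχ']
      simp [adPow_pair _ _ _ hkl]
    · by_cases hrt : r < t i
      · rw [LieDerivation.sub_apply, map_sub, hχ', map_sum, Finset.sum_eq_single i, map_sum,
          Finset.sum_eq_single r, map_smul, coef_adPow_single hrt, if_pos ⟨rfl, rfl⟩]
        · simp [b]
        · intro s _ hsr
          rw [map_smul, coef_adPow_single hrt, if_neg (fun h => hsr h.2), smul_zero]
        · intro h
          exact absurd (Finset.mem_Ico.2 ⟨hr, hrt⟩) h
        · intro i' _ hi'
          rw [map_sum]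
          refine Finset.sum_eq_zero fun s _ => ?_
          rw [map_smul, coef_adPow_single hrt, if_neg (fun h => hi' h.1), smul_zero]
        · simp
      · rw [apply_e_eq_zero_of_not, map_zero]
        intro h
        have := h.1 i
        simp only [Pi.single_eq_same] at this
        exact hrt ((Nat.pow_lt_pow_iff_right (Fact.out : p.Prime).one_lt).1 this)
  refine LieDerivation.ext fun z => ?_
  have h0 := hN.eq_zero hp hm hn ht z
  rw [LieDerivation.sub_apply, sub_eq_zero, hψ', sub_eq_iff_eq_add'] at h0
  rw [h0, LieDerivation.add_apply, ad_apply_apply]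

end DerivationAlgebra

end WittSuper

theorem theorem3p2p11 (F : Type*) [Field F] (p : ℕ) [Fact p.Prime] [CharP F p] (hp : 3 < p)
    (m n : ℕ) (hm : 3 ≤ m) (hn : 3 ≤ n) (t : Fin m → ℕ) (ht : ∀ i, 1 ≤ t i) :
    LinearMap.range (LieDerivation.toLinearMapLieHom F (WittSuper.evenW F n p t) :
        LieDerivation F (WittSuper.evenW F n p t) (WittSuper.evenW F n p t) →ₗ[F]
          Module.End F (WittSuper.evenW F n p t)) =
      LinearMap.range (LieAlgebra.ad F (WittSuper.evenW F n p t) :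
        WittSuper.evenW F n p t →ₗ[F] Module.End F (WittSuper.evenW F n p t)) ⊔
      Submodule.span F {φ | ∃ (i : Fin m) (r : ℕ), 1 ≤ r ∧ r < t i ∧
        φ = LieAlgebra.ad F (WittSuper.evenW F n p t) (WittSuper.evenD F n p t i) ^ p ^ r} ∧
    Disjoint
      (LinearMap.range (LieAlgebra.ad F (WittSuper.evenW F n p t) :
        WittSuper.evenW F n p t →ₗ[F] Module.End F (WittSuper.evenW F n p t)))
      (Submodule.span F {φ | ∃ (i : Fin m) (r : ℕ), 1 ≤ r ∧ r < t i ∧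
        φ = LieAlgebra.ad F (WittSuper.evenW F n p t) (WittSuper.evenD F n p t i) ^ p ^ r}) := by
  have hpow : ∀ i r, (WittSuper.adPow F n p t i r :
      WittSuper.evenW F n p t →ₗ[F] WittSuper.evenW F n p t) =
        LieAlgebra.ad F (WittSuper.evenW F n p t) (WittSuper.evenD F n p t i) ^ p ^ r :=
    fun i r => LinearMap.ext fun x => WittSuper.adPow_apply i r x
  refine ⟨le_antisymm ?_ (sup_le ?_ (Submodule.span_le.2 ?_)), ?_⟩
  · rintro _ ⟨φ, rfl⟩
    obtain ⟨x, b, rfl⟩ := WittSuper.exists_eq_add hp hm hn ht φ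
    rw [map_add]
    refine Submodule.add_mem_sup ⟨x, ?_⟩ ?_
    · exact (LieDerivation.coe_ad_apply_eq_ad_apply x).symm
    · rw [map_sum]
      refine Submodule.sum_mem _ fun i _ => ?_
      rw [map_sum]
      refine Submodule.sum_mem _ fun r hr => ?_
      rw [map_smul]
      exact Submodule.smul_mem _ _ (Submodule.subset_span
        ⟨i, r, (Finset.mem_Ico.1 hr).1, (Finset.mem_Ico.1 hr).2, hpow i r⟩)
  · rintro _ ⟨x, rfl⟩
    exact ⟨LieDerivation.ad F _ x, LieDerivation.coe_ad_apply_eq_ad_apply x⟩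
  · rintro _ ⟨i, r, -, -, rfl⟩
    exact ⟨WittSuper.adPow F n p t i r, hpow i r⟩
  · rw [Submodule.disjoint_def]
    rintro _ ⟨x, rfl⟩ hx
    have hker : ∀ y : WittSuper.evenW F n p t,
        (∀ i r, 1 ≤ r → WittSuper.adPow F n p t i r y = 0) → ⁅x, y⁆ = 0 := by
      intro y hy
      have hle : Submodule.span F {φ | ∃ (i : Fin m) (r : ℕ), 1 ≤ r ∧ r < t i ∧
          φ = LieAlgebra.ad F (WittSuper.evenW F n p t) (WittSuper.evenD F n p t i) ^ p ^ r} ≤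
          LinearMap.ker (LinearMap.applyₗ (R := F) y) := by
        refine Submodule.span_le.2 ?_
        rintro _ ⟨i, r, hr, -, rfl⟩
        exact LinearMap.mem_ker.2 ((WittSuper.adPow_apply i r y).symm.trans (hy i r hr))
      exact hle hx
    have h0 : x = 0 := WittSuper.eq_zero_of_lie hp hn ht
      (fun i => by rw [← lie_skew, hker _ fun i' r _ => WittSuper.adPow_evenD i' r i, neg_zero])
      (fun s => by
        rw [← lie_skew, hker _ fun i r hr => WittSuper.adPow_torus ht i hr s, neg_zero])
      ⟨0, by omega⟩ fun k l hkl => hker _ fun i r _ => WittSuper.adPow_pair i r _ hkl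
    rw [h0, map_zero]
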